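/- **Setting.** Let $H$ be a (purely even) finite-dimensional complex vector space with basis $\{\mathcal O_\alpha\}$, one basis element $P$ of which is distinguished, and let $\langle-\rangle_0$ be genus zero correlators on $H[[t]]$: for each $n$ a symmetric $n$-linear function, zero for $n<3$, such that, with $\mathcal O^{(k)}_\alpha=t^k\mathcal O_\alpha$ and $\langle\!\langle x_1\cdots x_r\rangle\!\rangle_0(\mathbf b)=\langle x_1\cdots x_r\exp(\sum b^\alpha_k\mathcal O^{(k)}_\alpha)\rangle_0$, the matrix $g_{\alpha\beta}=\langle\mathcal O_\alpha\mathcal O_\beta P\rangle_0$ is invertible, with inverse $g^{\alpha\beta}$, and the topological recursion relation $$\langle\!\langle \mathcal O^{(i+1)}_\alpha\mathcal O^{(j)}_\beta\mathcal O^{(k)}_\gamma\rangle\!\rangle_0=\sum_{\sigma,\tau}g^{\sigma\tau}\langle\!\langle \mathcal O^{(i)}_\alpha\mathcal O^{(0)}_\sigma\rangle\!\rangle_0\,\langle\!\langle \mathcal O^{(0)}_\tau\mathcal O^{(j)}_\beta\mathcal O^{(k)}_\gamma\rangle\!\rangle_0$$ holds. Let $\mathcal A=\mathbb C[[\partial_z^m\lambda^\alpha_k,\partial_z^m\rho^\alpha_k]]$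 be the formal differential ring in the even symbols $\partial_z^m\lambda^\alpha_k$ and odd symbols $\partial_z^m\rho^\alpha_k$ ($k,m\ge0$), $\partial_z$ its total derivative, and $\delta$ the odd derivation commuting with $\partial_z$ with $\delta\lambda^\alpha_k=\partial_z\rho^\alpha_{k-1}$ (zero for $k=0$), $\delta\rho^\alpha_k=0$. The symbols are evaluated on the components of a field $\mu=\sum_{k,\alpha}(\lambda^\alpha_k+\rho^\alpha_k\partial_z)\mathcal O_\alpha t^k$, $\lambda^\alpha_k,\rho^\alpha_k\in\Omega^{0,\bullet}(\mathbb C^\times)$, of the $H$-valued BCOV theory on $\mathbb C^\times=\mathbb C/\mathbb Z$ with coordinate $z\sim z+1$; for $\mathcal L\in\mathcal A$ put $\mathscr J_{\mathcal L}=dz\,\mathcal L=\mathscr J^{(1)}_{\mathcal L}+\mathscr J^{(2)}_{\mathcal L}$ ($1$-form and $2$-form parts), and let $C=\{z\in[0,1]\}$. Let $\mathrm{Obs}^{\oint_C}$ be the space of current observables $\oint_C\mathscr J^{(1)}_{\mathcal L}$, $\mathcal L\in\mathcal A$, taken modulo total derivatives, i.e. with $\oint_C\mathscr J^{(1)}_{\partial_z\mathcal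 L}=0$. It carries the differential $\delta\oint_C\mathscr J^{(1)}_{\mathcal L}=\oint_C\mathscr J^{(1)}_{\delta\mathcal L}$ and the bracket $$\Big\{\oint_C\mathscr J^{(1)}_{\mathcal L_1},\oint_C\mathscr J^{(1)}_{\mathcal L_2}\Big\}_C:=\Big\{\int_{\mathbb C^\times}\mathscr J^{(2)}_{\mathcal L_1},\oint_C\mathscr J^{(1)}_{\mathcal L_2}\Big\}_{\mathrm{BV}}=\oint_C\mathscr J^{(1)}_{\delta_{\mathcal L_1}\mathcal L_2},$$ where $\delta_{\mathcal L_1}$ is the derivation of $\mathcal A$ commuting with $\partial_z$ given by the Hamiltonian vector field of $\int_{\mathbb C^\times}\mathscr J^{(2)}_{\mathcal L_1}$ for the BV kernel $\sum g^{\alpha\beta}\mathcal O_\alpha\otimes\mathcal O_\beta\,\partial_z\delta(z-w)(d\bar z-d\bar w)$: on generators $\delta_{\mathcal L_1}\lambda^\beta_0=-\sum_{\alpha}g^{\alpha\beta}\,\partial_z\sum_m(-\partial_z)^m\frac{\partial\mathcal L_1}{\partial(\partial_z^m\lambda^\alpha_0)}$, and $\delta_{\mathcal L_1}\lambda^\beta_k=0$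 for $k>0$, $\delta_{\mathcal L_1}\rho^\beta_k=0$. Let $$\mathcal L^H=\sum_{k,\alpha}\rho^\alpha_k\Big\langle\mathcal O^{(k)}_\alpha\exp\Big(\sum_{m,\beta}\lambda^\beta_m\mathcal O^{(m)}_\beta\Big)\Big\rangle_0 .$$ **Proposition.** The current observable $\oint_C\mathscr J^{(1)}_{\mathcal L^H}$ satisfies the Maurer--Cartan equation in $(\mathrm{Obs}^{\oint_C},\delta,\{-,-\}_C)$: $$\delta\oint_C\mathscr J^{(1)}_{\mathcal L^H}+\tfrac12\Big\{\oint_C\mathscr J^{(1)}_{\mathcal L^H},\oint_C\mathscr J^{(1)}_{\mathcal L^H}\Big\}_C=0 .$$ In particular the equation holds for the honest contour integrals: for every $q\ge 0$ and every $\bar\partial$-closed BCOV field on $\mathbb C^\times$ of total even degree with coefficients in the Grassmann algebra on $q$ odd parameters (with finitely many non-zero components $\lambda^\alpha_k,\rho^\alpha_k$, the $\lambda^\alpha_k$ being nilpotent), one has $\oint_C\mathscr J^{(1)}_{\delta\mathcal L^H}+\tfrac12\oint_C\mathscr J^{(1)}_{\delta_{\mathcal L^H}\mathcal L^H}=0$.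 -/

import Mathlib

/-! ### Power series in anticommuting variables -/

/-- Formal power series in anticommuting variables `θ_y` (`y ∈ Y`) over a commutative ring `R`:
the family `f` stands for `∑ₛ f(s) θ_s`, where `θ_s` is the product of the `θ_y`, `y ∈ s`, in
increasing order. If `Y` is finite this is the Grassmann algebra on `Y`. -/
def Grass (Y R : Type*) : Type _ := Finset Y → R

namespace Grass

section Basic

variable {Y R : Type*}

instance [AddCommGroup R] : AddCommGroup (Grass Y R) :=
  inferInstanceAs (AddCommGroup (Finset Y → R))

instance {S : Type*} [Semiring S] [AddCommGroup R] [Module S R] : Module S (Grass Y R) :=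
  inferInstanceAs (Module S (Finset Y → R))

@[ext] theorem ext {f g : Grass Y R} (h : ∀ s, f s = g s) : f = g := funext h

@[simp] theorem zero_apply [AddCommGroup R] (s : Finset Y) : (0 : Grass Y R) s = 0 := rfl
@[simp] theorem add_apply [AddCommGroup R] (f g : Grass Y R) (s : Finset Y) :
    (f + g) s = f s + g s := rfl
@[simp] theorem neg_apply [AddCommGroup R] (f : Grass Y R) (s : Finset Y) :
    (-f) s = - f s := rfl
@[simp] theorem sub_apply [AddCommGroup R] (f g : Grass Y R) (s : Finset Y) :
    (f - g) s = f s - g s := rfl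
@[simp] theorem smul_apply {S : Type*} [Semiring S] [AddCommGroup R] [Module S R] (c : S)
    (f : Grass Y R) (s : Finset Y) : (c • f) s = c • f s := rfl
@[simp] theorem sum_apply [AddCommGroup R] {ι : Type*} (t : Finset ι) (f : ι → Grass Y R)
    (s : Finset Y) : (∑ i ∈ t, f i) s = ∑ i ∈ t, f i s :=
  Finset.sum_apply s t f

variable [LinearOrder Y]

/-- The sign with `θ_s θ_t = sgn s t • θ_{s ∪ t}` for disjoint `s`, `t`. -/
def sgn (s t : Finset Y) : ℤ := ∏ a ∈ s, ∏ b ∈ t, if b < a then -1 else 1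

variable [CommRing R]

instance : One (Grass Y R) := ⟨fun s => if s = ∅ then 1 else 0⟩

instance : Mul (Grass Y R) :=
  ⟨fun f g u => ∑ s ∈ u.powerset, (sgn s (u \ s) : R) * (f s * g (u \ s))⟩

theorem mul_apply (f g : Grass Y R) (u : Finset Y) :
    (f * g) u = ∑ s ∈ u.powerset, (sgn s (u \ s) : R) * (f s * g (u \ s)) := rfl

/-- Left multiplication by the generator `θ_v`. -/
def mulGen (v : Y) (f : Grass Y R) : Grass Y R :=
  fun u => if v ∈ u then (sgn {v} (u.erase v) : R) * f (u.erase v) else 0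

/-- The left derivative with respect to `θ_v`. -/
def contract (v : Y) (f : Grass Y R) : Grass Y R :=
  fun u => if v ∈ u then 0 else (sgn {v} u : R) * f (insert v u)

/-- The parity involution, `θ_s ↦ (-1)^|s| θ_s`. -/
def inv (f : Grass Y R) : Grass Y R := fun u => (-1) ^ u.card * f u

theorem sgn_insert_left {v : Y} {s : Finset Y} (h : v ∉ s) (t : Finset Y) :
    sgn (insert v s) t = sgn {v} t * sgn s t := by
  simp [sgn, Finset.prod_insert h]

theorem sgn_insert_right {v : Y} {t : Finset Y} (h : v ∉ t) (s : Finset Y) :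
    sgn s (insert v t) = sgn s {v} * sgn s t := by
  simp only [sgn, Finset.prod_singleton]
  rw [← Finset.prod_mul_distrib]
  exact Finset.prod_congr rfl fun a _ => Finset.prod_insert h

theorem sgn_sq (s t : Finset Y) : sgn s t * sgn s t = 1 := by
  unfold sgn
  rw [← Finset.prod_mul_distrib]
  refine Finset.prod_eq_one fun a _ => ?_
  rw [← Finset.prod_mul_distrib]
  refine Finset.prod_eq_one fun b _ => ?_
  split_ifs <;> norm_num

theorem sgn_swap {v : Y} {s : Finset Y} (h : v ∉ s) :
    sgn s {v} = (-1) ^ s.card * sgn {v} s := by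
  have : ∀ a ∈ s, (if v < a then (-1 : ℤ) else 1) = (-1) * (if a < v then -1 else 1) := by
    intro a ha
    have hne : a ≠ v := fun e => h (e ▸ ha)
    rcases lt_or_gt_of_ne hne with h1 | h1
    · simp [h1, not_lt.2 h1.le]
    · simp [h1, not_lt.2 h1.le]
  simp only [sgn, Finset.prod_singleton]
  rw [Finset.prod_congr rfl this, Finset.prod_mul_distrib, Finset.prod_const]

theorem sgn_split {v : Y} {s u : Finset Y} (h : s ⊆ u) :
    sgn {v} u = sgn {v} s * sgn {v} (u \ s) := by
  simp only [sgn, Finset.prod_singleton]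
  rw [mul_comm, Finset.prod_sdiff h]

theorem mulGen_mul (v : Y) (f h : Grass Y R) : mulGen v (f * h) = mulGen v f * h := by
  ext u
  by_cases hv : v ∈ u
  · obtain ⟨u, hv', rfl⟩ : ∃ u', v ∉ u' ∧ insert v u' = u :=
      ⟨u.erase v, Finset.notMem_erase _ _, Finset.insert_erase hv⟩
    rw [mul_apply, Finset.sum_powerset_insert hv']
    rw [Finset.sum_eq_zero (s := u.powerset), zero_add]
    · simp only [mulGen, hv, if_true, Finset.erase_insert hv', mul_apply, Finset.mul_sum]
      refine Finset.sum_congr rfl fun s hs => ?_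
      have hs' := Finset.mem_powerset.1 hs
      have hvs : v ∉ s := fun e => hv' (hs' e)
      have e1 : insert v u \ insert v s = u \ s := by
        ext x; simp only [Finset.mem_sdiff, Finset.mem_insert]; grind
      rw [if_pos (Finset.mem_insert_self _ _), Finset.erase_insert hvs, e1,
        sgn_insert_left hvs, sgn_split hs']
      push_cast; ring
    · intro s hs
      have hvs : v ∉ s := fun e => hv' (Finset.mem_powerset.1 hs e)
      simp [mulGen, hvs]
  · rw [mul_apply, Finset.sum_eq_zero]
    · simp [mulGen, hv]
    · intro s hs
      have hvs : v ∉ s := fun e => hv (Finset.mem_powerset.1 hs e)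
      simp [mulGen, hvs]

theorem mul_mulGen (v : Y) (f h : Grass Y R) : f * mulGen v h = mulGen v (inv f * h) := by
  ext u
  by_cases hv : v ∈ u
  · obtain ⟨u, hv', rfl⟩ : ∃ u', v ∉ u' ∧ insert v u' = u :=
      ⟨u.erase v, Finset.notMem_erase _ _, Finset.insert_erase hv⟩
    rw [mul_apply, Finset.sum_powerset_insert hv']
    rw [Finset.sum_eq_zero (s := u.powerset) (f := fun t => _ * (f (insert v t) * _)), add_zero]
    · simp only [mulGen, hv, if_true, Finset.erase_insert hv', mul_apply, Finset.mul_sum]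
      refine Finset.sum_congr rfl fun s hs => ?_
      have hs' := Finset.mem_powerset.1 hs
      have hvs : v ∉ s := fun e => hv' (hs' e)
      have hvt : v ∉ u \ s := fun e => hv' (Finset.mem_sdiff.1 e).1
      have e1 : insert v u \ s = insert v (u \ s) := Finset.insert_sdiff_of_notMem _ hvs
      rw [e1, if_pos (Finset.mem_insert_self _ _), Finset.erase_insert hvt,
        sgn_insert_right hvt, sgn_split hs', sgn_swap hvs, inv]
      push_cast; ring
    · intro s hs
      simp [mulGen]
  · rw [mul_apply, Finset.sum_eq_zero]
    · simp [mulGen, hv]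
    · intro s hs
      have hvs : v ∉ u \ s := fun e => hv (Finset.mem_sdiff.1 e).1
      simp [mulGen, hvs]

theorem contract_mul (v : Y) (f h : Grass Y R) :
    contract v (f * h) = contract v f * h + inv f * contract v h := by
  ext u
  by_cases hv : v ∈ u
  · obtain ⟨u, hv', rfl⟩ : ∃ u', v ∉ u' ∧ insert v u' = u :=
      ⟨u.erase v, Finset.notMem_erase _ _, Finset.insert_erase hv⟩
    rw [add_apply, mul_apply, mul_apply, ← Finset.sum_add_distrib,
      Finset.sum_powerset_insert hv', ← Finset.sum_add_distrib]
    rw [contract, if_pos hv]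
    symm
    refine Finset.sum_eq_zero fun s hs => ?_
    have hs' := Finset.mem_powerset.1 hs
    have hvs : v ∉ s := fun e => hv' (hs' e)
    have hvt : v ∉ u \ s := fun e => hv' (Finset.mem_sdiff.1 e).1
    have e1 : insert v u \ s = insert v (u \ s) := Finset.insert_sdiff_of_notMem _ hvs
    have e2 : insert v u \ insert v s = u \ s := by
      ext x; simp only [Finset.mem_sdiff, Finset.mem_insert]; grind
    rw [e1, e2]
    simp only [contract, hvs, hvt, if_false, Finset.mem_insert_self, if_true, inv,
      Finset.card_insert_of_notMem hvs]
    rw [sgn_insert_left hvs, sgn_insert_right hvt, sgn_swap hvs]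
    have a1 : ((sgn {v} s : ℤ) : R) * (sgn {v} s : ℤ) = 1 := by
      rw [← Int.cast_mul, sgn_sq]; simp
    have a2 : ((sgn {v} (u \ s) : ℤ) : R) * (sgn {v} (u \ s) : ℤ) = 1 := by
      rw [← Int.cast_mul, sgn_sq]; simp
    push_cast
    linear_combination ((-1) ^ s.card * (sgn s (u \ s) : R) * f (insert v s) *
      h (insert v (u \ s))) * (a1 - a2)
  · rw [add_apply, mul_apply, mul_apply, ← Finset.sum_add_distrib]
    simp only [contract, hv, if_false]
    rw [mul_apply, Finset.sum_powerset_insert hv, ← Finset.sum_add_distrib, Finset.mul_sum]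
    refine Finset.sum_congr rfl fun s hs => ?_
    have hs' := Finset.mem_powerset.1 hs
    have hvs : v ∉ s := fun e => hv (hs' e)
    have hvt : v ∉ u \ s := fun e => hv (Finset.mem_sdiff.1 e).1
    have e1 : insert v u \ s = insert v (u \ s) := Finset.insert_sdiff_of_notMem _ hvs
    have e2 : insert v u \ insert v s = u \ s := by
      ext x; simp only [Finset.mem_sdiff, Finset.mem_insert]; grind
    rw [e1, e2]
    simp only [hvs, hvt, if_false, inv]
    rw [sgn_insert_left hvs, sgn_insert_right hvt, sgn_swap hvs, sgn_split hs']
    have a1 : ((sgn {v} s : ℤ) : R) * (sgn {v} s : ℤ) = 1 := by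
      rw [← Int.cast_mul, sgn_sq]; simp
    have a2 : ((sgn {v} (u \ s) : ℤ) : R) * (sgn {v} (u \ s) : ℤ) = 1 := by
      rw [← Int.cast_mul, sgn_sq]; simp
    push_cast
    linear_combination ((-1) ^ s.card * (sgn s (u \ s) : R) * (sgn {v} (u \ s) : R) * f s *
      h (insert v (u \ s))) * a1 + ((sgn s (u \ s) : R) * (sgn {v} s : R) * f (insert v s) *
      h (u \ s)) * a2

theorem one_mul (f : Grass Y R) : 1 * f = f := by
  ext u
  rw [mul_apply, Finset.sum_eq_single ∅]
  · have : (1 : Grass Y R) ∅ = 1 := if_pos rfl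
    simp [this, sgn]
  · intro s _ hs
    have : (1 : Grass Y R) s = 0 := if_neg hs
    simp [this]
  · simp

theorem mulGen_add (v : Y) (f h : Grass Y R) : mulGen v (f + h) = mulGen v f + mulGen v h := by
  ext u
  simp only [mulGen, add_apply]
  split_ifs <;> ring

theorem mulGen_apply_of_notMem {v : Y} {u : Finset Y} (h : v ∉ u) (f : Grass Y R) :
    mulGen v f u = 0 := if_neg h

theorem contract_add (v : Y) (f h : Grass Y R) :
    contract v (f + h) = contract v f + contract v h := by
  ext u
  simp only [contract, add_apply]
  split_ifs <;> ring

theorem mulGen_smul {S : Type*} [CommSemiring S] [Algebra S R] (v : Y) (c : S) (f : Grass Y R) :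
    mulGen v (c • f) = c • mulGen v f := by
  ext u
  simp only [mulGen, smul_apply]
  split_ifs <;> simp

theorem contract_smul {S : Type*} [CommSemiring S] [Algebra S R] (v : Y) (c : S)
    (f : Grass Y R) : contract v (c • f) = c • contract v f := by
  ext u
  simp only [contract, smul_apply]
  split_ifs <;> simp

theorem add_mul (f h k : Grass Y R) : (f + h) * k = f * k + h * k := by
  ext u
  simp only [mul_apply, add_apply, ← Finset.sum_add_distrib]
  exact Finset.sum_congr rfl fun s _ => by ring

theorem mul_add (f h k : Grass Y R) : k * (f + h) = k * f + k * h := by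
  ext u
  simp only [mul_apply, add_apply, ← Finset.sum_add_distrib]
  exact Finset.sum_congr rfl fun s _ => by ring

theorem smul_mul {S : Type*} [CommSemiring S] [Algebra S R] (c : S) (f k : Grass Y R) :
    (c • f) * k = c • (f * k) := by
  ext u
  simp only [mul_apply, smul_apply, Finset.smul_sum]
  exact Finset.sum_congr rfl fun s _ => by simp

theorem mul_smul' {S : Type*} [CommSemiring S] [Algebra S R] (c : S) (f k : Grass Y R) :
    f * (c • k) = c • (f * k) := by
  ext u
  simp only [mul_apply, smul_apply, Finset.smul_sum]
  exact Finset.sum_congr rfl fun s _ => by simp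

end Basic

end Grass

/-! ### The formal differential ring `ℂ⟦∂_z^m λ^α_k, ∂_z^m ρ^α_k⟧` -/

/-- An index `(α, k, m)`, standing for both the even symbol `∂_z^m λ^α_k` and the odd symbol
`∂_z^m ρ^α_k`. -/
structure Jet (N : ℕ) where
  idx : Fin N
  lvl : ℕ
  ord : ℕ

namespace Jet

variable {N : ℕ}

/-- The lexicographic order. -/
noncomputable instance : LinearOrder (Jet N) :=
  LinearOrder.lift' (fun g => toLex (g.idx, toLex (g.lvl, g.ord))) <| by
    rintro ⟨a, k, m⟩ ⟨b, l, n⟩ h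
    simpa using h

/-- `∂_z^m x ↦ ∂_z^(m-1) x` (used for `m ≠ 0`). -/
def lower (v : Jet N) : Jet N := ⟨v.idx, v.lvl, v.ord - 1⟩

/-- `∂_z^m x ↦ ∂_z^(m+1) x`. -/
def raise (v : Jet N) : Jet N := ⟨v.idx, v.lvl, v.ord + 1⟩

theorem lower_raise (v : Jet N) : v.raise.lower = v := rfl

theorem raise_lower {v : Jet N} (h : v.ord ≠ 0) : v.lower.raise = v := by
  obtain ⟨a, k, m⟩ := v
  cases m with
  | zero => exact absurd rfl h
  | succ m => rfl

end Jet

/-- Formal power series in the even symbols `∂_z^m λ^α_k`. -/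
abbrev EvenSeries (N : ℕ) : Type := MvPowerSeries (Jet N) ℂ

/-- The ring `ℂ⟦∂_z^m λ^α_k, ∂_z^m ρ^α_k⟧` of formal power series in the even symbols
`∂_z^m λ^α_k` and the odd symbols `∂_z^m ρ^α_k`, `α ∈ Fin N`, `k, m ∈ ℕ`. -/
abbrev Density (N : ℕ) : Type := Grass (Jet N) (EvenSeries N)

namespace Density

open MvPowerSeries Grass

variable {N : ℕ}

/-- The partial derivative with respect to the even symbol indexed by `g`. -/
noncomputable def pd (g : Jet N) : Density N →ₗ[ℂ] Density N where
  toFun f := fun u => pderiv ℂ g (f u)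
  map_add' f h := Grass.ext fun u => map_add (pderiv ℂ g) (f u) (h u)
  map_smul' c f := Grass.ext fun u => (pderiv ℂ g).map_smul c (f u)

theorem pd_apply (g : Jet N) (f : Density N) (u : Finset (Jet N)) :
    pd g f u = pderiv ℂ g (f u) := rfl

/-- `∑ ∂_z^(m+1) λ^α_k · ∂/∂(∂_z^m λ^α_k)`. In a given degree `n` only the finitely many terms
with `∂_z^(m+1) λ^α_k` in the support of `n` contribute. -/
noncomputable def evenTotalDeriv : EvenSeries N →ₗ[ℂ] EvenSeries N where
  toFun F := fun n => ∑ v ∈ n.support with v.ord ≠ 0, coeff n (X v * pderiv ℂ v.lower F)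
  map_add' F G := by
    ext n
    simp only [map_add, _root_.mul_add, Finset.sum_add_distrib]
    rfl
  map_smul' c F := by
    ext n
    simp only [RingHom.id_apply]
    change _ = c • ∑ v ∈ n.support with v.ord ≠ 0, coeff n (X v * pderiv ℂ v.lower F)
    rw [Finset.smul_sum]
    refine Finset.sum_congr rfl fun v _ => ?_
    rw [Derivation.map_smul, mul_smul_comm, map_smul]

/-- `∑ ∂_z^(m+1) ρ^α_k · ∂/∂(∂_z^m ρ^α_k)`. -/
noncomputable def oddTotalDeriv : Density N →ₗ[ℂ] Density N where
  toFun f := fun u => ∑ v ∈ u with v.ord ≠ 0, mulGen v (contract v.lower f) u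
  map_add' f h := Grass.ext fun u => by
    change _ = (∑ v ∈ u with v.ord ≠ 0, mulGen v (contract v.lower f) u) +
      ∑ v ∈ u with v.ord ≠ 0, mulGen v (contract v.lower h) u
    simp only [contract_add, mulGen_add, Grass.add_apply, Finset.sum_add_distrib]
  map_smul' c f := Grass.ext fun u => by
    change _ = c • ∑ v ∈ u with v.ord ≠ 0, mulGen v (contract v.lower f) u
    simp only [contract_smul, mulGen_smul, Grass.smul_apply, Finset.smul_sum]

/-- The total derivative `∂_z`, the even derivation with `∂_z (∂_z^m x) = ∂_z^(m+1) x` for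
`x = λ^α_k, ρ^α_k`. -/
noncomputable def totalDeriv : Density N →ₗ[ℂ] Density N where
  toFun f := fun u => evenTotalDeriv (f u) + oddTotalDeriv f u
  map_add' f h := Grass.ext fun u => by
    change evenTotalDeriv (f u + h u) + oddTotalDeriv (f + h) u =
      (evenTotalDeriv (f u) + oddTotalDeriv f u) + (evenTotalDeriv (h u) + oddTotalDeriv h u)
    simp only [map_add, Grass.add_apply]; abel
  map_smul' c f := Grass.ext fun u => by
    change evenTotalDeriv (c • f u) + oddTotalDeriv (c • f) u =
      c • (evenTotalDeriv (f u) + oddTotalDeriv f u)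
    simp only [map_smul, Grass.smul_apply, smul_add]

/-- The differential `δ`, the odd derivation commuting with `∂_z` with
`δ λ^α_k = ∂_z ρ^α_(k-1)` (`= 0` for `k = 0`) and `δ ρ^α_k = 0`, that is
`δ = ∑ ∂_z^(m+1) ρ^α_k · ∂/∂(∂_z^m λ^α_(k+1))`. -/
noncomputable def delta : Density N →ₗ[ℂ] Density N where
  toFun f := fun u => ∑ v ∈ u with v.ord ≠ 0, mulGen v (pd ⟨v.idx, v.lvl + 1, v.ord - 1⟩ f) u
  map_add' f h := Grass.ext fun u => by
    change _ = (∑ v ∈ u with v.ord ≠ 0, mulGen v (pd ⟨v.idx, v.lvl + 1, v.ord - 1⟩ f) u) +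
      ∑ v ∈ u with v.ord ≠ 0, mulGen v (pd ⟨v.idx, v.lvl + 1, v.ord - 1⟩ h) u
    simp only [map_add, mulGen_add, Grass.add_apply, Finset.sum_add_distrib]
  map_smul' c f := Grass.ext fun u => by
    change _ = c • ∑ v ∈ u with v.ord ≠ 0, mulGen v (pd ⟨v.idx, v.lvl + 1, v.ord - 1⟩ f) u
    simp only [map_smul, mulGen_smul, Grass.smul_apply, Finset.smul_sum]

/-- The number of `z`-derivatives in the monomial `λ^n ρ_u`. -/
noncomputable def weight (u : Finset (Jet N)) (n : Jet N →₀ ℕ) : ℕ :=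
  ∑ v ∈ u, v.ord + n.sum fun v e => e * v.ord

/-- The sum `∑_m a m` of a sequence of densities for which all monomials of `a m` contain at
least `m` derivatives. -/
noncomputable def jetSum (a : ℕ → Density N) : Density N :=
  fun u n => ∑ m ∈ Finset.range (weight u n + 1), coeff n (a m u)

theorem coeff_jetSum (a : ℕ → Density N) (u : Finset (Jet N)) (n : Jet N →₀ ℕ) :
    coeff n (jetSum a u) = ∑ m ∈ Finset.range (weight u n + 1), coeff n (a m u) := rfl

theorem jetSum_add (a b : ℕ → Density N) : jetSum (fun m => a m + b m) = jetSum a + jetSum b := by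
  ext u n
  simp only [coeff_jetSum, Grass.add_apply, map_add, Finset.sum_add_distrib]

theorem jetSum_smul (c : ℂ) (a : ℕ → Density N) : jetSum (fun m => c • a m) = c • jetSum a := by
  ext u n
  simp only [coeff_jetSum, Grass.smul_apply, map_smul, Finset.smul_sum]

/-- The variational derivative `∑_m (-∂_z)^m ∂L/∂(∂_z^m λ^α_0)` with respect to `λ^α_0` of the
local functional with density `L`. -/
noncomputable def varDeriv (α : Fin N) : Density N →ₗ[ℂ] Density N where
  toFun L := jetSum fun m => (-1 : ℂ) ^ m • (totalDeriv ^ m) (pd ⟨α, 0, m⟩ L)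
  map_add' L L' := by
    simp only [map_add, smul_add, jetSum_add]
  map_smul' c L := by
    simp only [map_smul, smul_comm _ c, jetSum_smul, RingHom.id_apply]

/-- The Hamiltonian vector field of the local functional `S = ∫ dz L` for the BV kernel
`∑ G^{αβ} 𝒪_α ⊗ 𝒪_β ∂_z δ(z-w)`: its only non-zero components are
`δ_S λ^β_0 = -∑_α G^{αβ} ∂_z (δS/δλ^α_0)`. -/
noncomputable def hamField (G : Matrix (Fin N) (Fin N) ℂ) (β : Fin N) :
    Density N →ₗ[ℂ] Density N :=
  -∑ α, G α β • (totalDeriv ∘ₗ varDeriv α)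

/-- The derivation `δ_S` of the ring of densities induced by the infinitesimal transformation
`λ^β_0 ↦ hamField G β L`; it commutes with `∂_z`, hence is
`∑_{β,m} ∂_z^m (δ_S λ^β_0) ∂/∂(∂_z^m λ^β_0)`. -/
noncomputable def hamDeriv (G : Matrix (Fin N) (Fin N) ℂ) :
    Density N →ₗ[ℂ] Density N →ₗ[ℂ] Density N :=
  LinearMap.mk₂ ℂ
    (fun L f => jetSum fun m => ∑ β, (totalDeriv ^ m) (hamField G β L) * pd ⟨β, 0, m⟩ f)
    (fun L L' f => by
      simp only [map_add, Grass.add_mul, Finset.sum_add_distrib, jetSum_add])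
    (fun c L f => by
      simp only [map_smul, Grass.smul_mul, ← Finset.smul_sum, jetSum_smul])
    (fun L f f' => by
      simp only [map_add, Grass.mul_add, Finset.sum_add_distrib, jetSum_add])
    (fun c L f => by
      simp only [map_smul, Grass.mul_smul', ← Finset.smul_sum, jetSum_smul])

/-! #### Total derivatives -/

theorem coeff_X_mul_of_notMem {n : Jet N →₀ ℕ} {v : Jet N} (h : v ∉ n.support)
    (F : EvenSeries N) : coeff n (X v * F) = 0 :=
  (X_dvd_iff.1 (dvd_mul_right (X v) F)) n (Finsupp.notMem_support_iff.1 h)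

theorem coeff_evenTotalDeriv {n : Jet N →₀ ℕ} {U : Finset (Jet N)} (h : n.support ⊆ U)
    (F : EvenSeries N) : coeff n (evenTotalDeriv F) =
      ∑ v ∈ U with v.ord ≠ 0, coeff n (X v * pderiv ℂ v.lower F) := by
  refine Finset.sum_subset (Finset.filter_subset_filter _ h) fun v hv hv' => ?_
  refine coeff_X_mul_of_notMem (fun e => hv' ?_) _
  exact Finset.mem_filter.2 ⟨e, (Finset.mem_filter.1 hv).2⟩

theorem oddTotalDeriv_apply {u U : Finset (Jet N)} (h : u ⊆ U) (f : Density N) :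
    oddTotalDeriv f u = ∑ v ∈ U with v.ord ≠ 0, mulGen v (contract v.lower f) u := by
  refine Finset.sum_subset (Finset.filter_subset_filter _ h) fun v hv hv' => ?_
  refine mulGen_apply_of_notMem (fun e => hv' ?_) _
  exact Finset.mem_filter.2 ⟨e, (Finset.mem_filter.1 hv).2⟩

theorem delta_apply {u U : Finset (Jet N)} (h : u ⊆ U) (f : Density N) :
    delta f u = ∑ v ∈ U with v.ord ≠ 0, mulGen v (pd ⟨v.idx, v.lvl + 1, v.ord - 1⟩ f) u := by
  refine Finset.sum_subset (Finset.filter_subset_filter _ h) fun v hv hv' => ?_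
  refine mulGen_apply_of_notMem (fun e => hv' ?_) _
  exact Finset.mem_filter.2 ⟨e, (Finset.mem_filter.1 hv).2⟩

theorem totalDeriv_apply (f : Density N) (u : Finset (Jet N)) :
    totalDeriv f u = evenTotalDeriv (f u) + oddTotalDeriv f u := rfl

theorem evenTotalDeriv_mul (F G : EvenSeries N) :
    evenTotalDeriv (F * G) = evenTotalDeriv F * G + F * evenTotalDeriv G := by
  ext n
  have e1 : ∀ p ∈ Finset.HasAntidiagonal.antidiagonal n, p.1.support ⊆ n.support := fun p hp => by
    rw [← Finset.HasAntidiagonal.mem_antidiagonal.1 hp]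
    intro x hx
    simp only [Finsupp.mem_support_iff, Finsupp.add_apply] at hx ⊢
    omega
  have e2 : ∀ p ∈ Finset.HasAntidiagonal.antidiagonal n, p.2.support ⊆ n.support := fun p hp => by
    rw [← Finset.HasAntidiagonal.mem_antidiagonal.1 hp]
    intro x hx
    simp only [Finsupp.mem_support_iff, Finsupp.add_apply] at hx ⊢
    omega
  have h1 : coeff n (evenTotalDeriv F * G) =
      ∑ v ∈ n.support with v.ord ≠ 0, coeff n (X v * pderiv ℂ v.lower F * G) := by
    simp only [coeff_mul n _ G]
    rw [Finset.sum_comm]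
    refine Finset.sum_congr rfl fun p hp => ?_
    rw [coeff_evenTotalDeriv (e1 p hp), Finset.sum_mul]
  have h2 : coeff n (F * evenTotalDeriv G) =
      ∑ v ∈ n.support with v.ord ≠ 0, coeff n (F * (X v * pderiv ℂ v.lower G)) := by
    simp only [coeff_mul n F]
    rw [Finset.sum_comm]
    refine Finset.sum_congr rfl fun p hp => ?_
    rw [coeff_evenTotalDeriv (e2 p hp), Finset.mul_sum]
  rw [map_add, h1, h2, coeff_evenTotalDeriv subset_rfl, ← Finset.sum_add_distrib]
  refine Finset.sum_congr rfl fun v _ => ?_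
  rw [← map_add]
  congr 1
  rw [Derivation.leibniz, smul_eq_mul, smul_eq_mul]
  ring

theorem pderiv_comm (x y : Jet N) (F : EvenSeries N) :
    pderiv ℂ x (pderiv ℂ y F) = pderiv ℂ y (pderiv ℂ x F) := by
  by_cases h : x = y
  · rw [h]
  · ext n
    simp only [coeff_pderiv, Finsupp.add_apply, Finsupp.single_eq_of_ne h,
      Finsupp.single_eq_of_ne (Ne.symm h), add_right_comm n (Finsupp.single x 1), add_zero]
    ring

theorem pderiv_evenTotalDeriv (x : Jet N) (F : EvenSeries N) :
    pderiv ℂ x (evenTotalDeriv F) =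
      evenTotalDeriv (pderiv ℂ x F) + if x.ord = 0 then 0 else pderiv ℂ x.lower F := by
  ext n
  have h1 : (n + Finsupp.single x 1).support ⊆ insert x n.support := by
    intro y hy
    by_cases h : y = x
    · simp [h]
    · simpa [h, Finsupp.single_eq_of_ne h] using hy
  rw [coeff_pderiv, coeff_evenTotalDeriv h1, Finset.sum_mul, map_add,
    coeff_evenTotalDeriv (Finset.subset_insert x n.support)]
  have h2 : ∀ v : Jet N, coeff (n + Finsupp.single x 1) (X v * pderiv ℂ v.lower F) * (n x + 1 : ℂ)
      = coeff n (X v * pderiv ℂ v.lower (pderiv ℂ x F)) +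
        if v = x then coeff n (pderiv ℂ v.lower F) else 0 := by
    intro v
    rw [← coeff_pderiv, Derivation.leibniz, smul_eq_mul, smul_eq_mul, pderiv_comm, map_add]
    congr 1
    by_cases h : v = x
    · rw [if_pos h, h, pderiv_X_self, mul_one]
    · rw [if_neg h, pderiv_X_of_ne h, mul_zero, map_zero]
  simp only [h2, Finset.sum_add_distrib]
  congr 1
  rw [Finset.sum_ite_eq']
  by_cases h : x.ord = 0 <;> simp [h]

theorem pd_mulGen (x v : Jet N) (f : Density N) : pd x (mulGen v f) = mulGen v (pd x f) := by
  ext1 u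
  simp only [pd_apply, mulGen]
  split_ifs
  · rw [← zsmul_eq_mul, ← zsmul_eq_mul, map_zsmul]
  · exact map_zero _

theorem pd_contract (x v : Jet N) (f : Density N) :
    pd x (contract v f) = contract v (pd x f) := by
  ext1 u
  simp only [pd_apply, contract]
  split_ifs
  · exact map_zero _
  · rw [← zsmul_eq_mul, ← zsmul_eq_mul, map_zsmul]

theorem pd_totalDeriv (x : Jet N) (f : Density N) :
    pd x (totalDeriv f) = totalDeriv (pd x f) + if x.ord = 0 then 0 else pd x.lower f := by
  ext1 u
  have h : pderiv ℂ x (oddTotalDeriv f u) = oddTotalDeriv (pd x f) u := by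
    rw [oddTotalDeriv_apply subset_rfl, oddTotalDeriv_apply subset_rfl, map_sum]
    refine Finset.sum_congr rfl fun v _ => ?_
    rw [← pd_apply, pd_mulGen, pd_contract]
  rw [Grass.add_apply, pd_apply, totalDeriv_apply, map_add, pderiv_evenTotalDeriv, h,
    totalDeriv_apply, pd_apply]
  split_ifs
  · rw [Grass.zero_apply]; abel
  · rw [pd_apply]; abel

theorem oddTotalDeriv_mul (f h : Density N) :
    oddTotalDeriv (f * h) = oddTotalDeriv f * h + f * oddTotalDeriv h := by
  ext1 u
  rw [Grass.add_apply, mul_apply, mul_apply, oddTotalDeriv_apply subset_rfl]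
  have h1 : ∑ s ∈ u.powerset, (sgn s (u \ s) : EvenSeries N) *
      (oddTotalDeriv f s * h (u \ s)) = ∑ v ∈ u with v.ord ≠ 0,
        (mulGen v (contract v.lower f) * h) u := by
    simp only [mul_apply]
    rw [Finset.sum_comm]
    refine Finset.sum_congr rfl fun s hs => ?_
    rw [oddTotalDeriv_apply (Finset.mem_powerset.1 hs), Finset.sum_mul, Finset.mul_sum]
  have h2 : ∑ s ∈ u.powerset, (sgn s (u \ s) : EvenSeries N) *
      (f s * oddTotalDeriv h (u \ s)) = ∑ v ∈ u with v.ord ≠ 0,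
        (f * mulGen v (contract v.lower h)) u := by
    simp only [mul_apply]
    rw [Finset.sum_comm]
    refine Finset.sum_congr rfl fun s hs => ?_
    rw [oddTotalDeriv_apply (Finset.sdiff_subset (s := u) (t := s)), Finset.mul_sum,
      Finset.mul_sum]
  rw [h1, h2, ← Finset.sum_add_distrib]
  refine Finset.sum_congr rfl fun v _ => ?_
  rw [contract_mul, mulGen_add, Grass.add_apply, mulGen_mul, ← mul_mulGen]

theorem totalDeriv_mul (f h : Density N) :
    totalDeriv (f * h) = totalDeriv f * h + f * totalDeriv h := by
  ext1 u
  have h1 : evenTotalDeriv ((f * h) u) =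
      ∑ s ∈ u.powerset, (sgn s (u \ s) : EvenSeries N) * (evenTotalDeriv (f s) * h (u \ s)) +
      ∑ s ∈ u.powerset, (sgn s (u \ s) : EvenSeries N) * (f s * evenTotalDeriv (h (u \ s))) := by
    rw [mul_apply, map_sum, ← Finset.sum_add_distrib]
    refine Finset.sum_congr rfl fun s _ => ?_
    rw [← zsmul_eq_mul, map_zsmul, evenTotalDeriv_mul, zsmul_eq_mul, _root_.mul_add]
  rw [totalDeriv_apply, oddTotalDeriv_mul, h1, Grass.add_apply, Grass.add_apply]
  simp only [mul_apply, totalDeriv_apply, _root_.add_mul, _root_.mul_add,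
    Finset.sum_add_distrib]
  abel

theorem evenTotalDeriv_one : evenTotalDeriv (1 : EvenSeries N) = 0 := by
  have := evenTotalDeriv_mul (1 : EvenSeries N) 1
  simpa using this

theorem totalDeriv_mulGen_one (v : Jet N) :
    totalDeriv (mulGen v (1 : Density N)) = mulGen v.raise 1 := by
  have h1 : ∀ (w : Jet N) (u : Finset (Jet N)), mulGen w (1 : Density N) u =
      if u = {w} then 1 else 0 := by
    intro w u
    by_cases hu : u = {w}
    · subst hu
      have e : ({w} : Finset (Jet N)).erase w = ∅ := by simp
      have e' : (1 : Density N) (({w} : Finset (Jet N)).erase w) = 1 := if_pos e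
      simp only [mulGen, Finset.mem_singleton, if_true, e']
      simp [sgn]
    · by_cases hw : w ∈ u
      · have : u.erase w ≠ ∅ := fun e => hu (by
          rw [← Finset.insert_erase hw, e]; rfl)
        have : (1 : Density N) (u.erase w) = 0 := if_neg this
        simp [mulGen, this, hu]
      · simp [mulGen, hw, hu]
  ext1 u
  rw [totalDeriv_apply, oddTotalDeriv_apply subset_rfl, h1, h1]
  have h2 : evenTotalDeriv (if u = {v} then (1 : EvenSeries N) else 0) = 0 := by
    split_ifs
    · exact evenTotalDeriv_one
    · exact map_zero _
  rw [h2, _root_.zero_add]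
  have h3 : ∀ w : Jet N, contract w (mulGen v (1 : Density N)) = if w = v then 1 else 0 := by
    intro w
    ext1 s
    have e1 : (1 : Density N) s = if s = ∅ then 1 else 0 := rfl
    simp only [contract, h1]
    by_cases hs : s = ∅
    · subst hs
      by_cases hw : w = v
      · simp [hw, e1, sgn]
      · simp [hw]
    · have : (if w = v then (1 : Density N) else 0) s = 0 := by
        split_ifs
        · rw [e1, if_neg hs]
        · rfl
      rw [this]
      by_cases hws : w ∈ s
      · rw [if_pos hws]
      · rw [if_neg hws, if_neg, mul_zero]
        intro e
        apply hs
        have hwv : w = v := by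
          have := Finset.mem_insert_self w s
          rw [e] at this; simpa using this
        subst hwv
        apply Finset.eq_empty_of_forall_notMem
        intro x hx
        have hx' : x ∈ ({w} : Finset (Jet N)) := e ▸ Finset.mem_insert_of_mem hx
        rw [Finset.mem_singleton] at hx'
        exact hws (hx' ▸ hx)
  have h4 : ∀ w : Jet N, mulGen w (contract w.lower (mulGen v (1 : Density N))) u =
      if w.lower = v then (if u = {w} then 1 else 0) else 0 := by
    intro w
    rw [h3]
    split_ifs with a b
    · rw [h1, if_pos b]
    · rw [h1, if_neg b]
    · simp [mulGen]
  simp only [h4]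
  by_cases hu : u = {v.raise}
  · subst hu
    rw [if_pos rfl, Finset.sum_filter, Finset.sum_singleton, if_pos (by simp [Jet.raise]),
      if_pos (Jet.lower_raise v), if_pos rfl]
  · rw [if_neg hu]
    refine Finset.sum_eq_zero fun w hw => ?_
    split_ifs with a b
    · exfalso
      apply hu
      rw [b, ← a, Jet.raise_lower (Finset.mem_filter.1 hw).2]
    · rfl
    · rfl

theorem totalDeriv_mulGen (v : Jet N) (f : Density N) :
    totalDeriv (mulGen v f) = mulGen v.raise f + mulGen v (totalDeriv f) := by
  have h : ∀ (w : Jet N) (k : Density N), mulGen w k = mulGen w 1 * k := fun w k => by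
    rw [← mulGen_mul, Grass.one_mul]
  rw [h v f, totalDeriv_mul, totalDeriv_mulGen_one, ← h, ← h]

theorem totalDeriv_congr {f h : Density N} {u U : Finset (Jet N)} (hU : u ⊆ U)
    (hU' : ∀ v ∈ u, v.lower ∈ U) (e : ∀ s ⊆ U, f s = h s) : totalDeriv f u = totalDeriv h u := by
  rw [totalDeriv_apply, totalDeriv_apply, e u hU, oddTotalDeriv_apply subset_rfl,
    oddTotalDeriv_apply subset_rfl]
  congr 1
  refine Finset.sum_congr rfl fun v hv => ?_
  have hvu := (Finset.mem_filter.1 hv).1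
  simp only [mulGen, contract]
  rw [e]
  exact Finset.insert_subset (hU' v hvu) ((Finset.erase_subset _ _).trans hU)

theorem delta_totalDeriv (f : Density N) : delta (totalDeriv f) = totalDeriv (delta f) := by
  ext1 u
  set U : Finset (Jet N) := u ∪ u.image Jet.lower with hUdef
  have hU : u ⊆ U := Finset.subset_union_left
  have hU' : ∀ v ∈ u, v.lower ∈ U := fun v hv =>
    Finset.mem_union_right _ (Finset.mem_image_of_mem _ hv)
  let σ : Jet N → Jet N := fun v => ⟨v.idx, v.lvl + 1, v.ord - 1⟩
  rw [totalDeriv_congr (h := ∑ v ∈ U with v.ord ≠ 0, mulGen v (pd (σ v) f)) hU hU' (fun s hs => by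
    rw [delta_apply hs, Grass.sum_apply]), map_sum, Grass.sum_apply]
  simp only [totalDeriv_mulGen, Grass.add_apply, Finset.sum_add_distrib]
  rw [delta_apply hU]
  simp only [pd_totalDeriv, mulGen_add, Grass.add_apply, Finset.sum_add_distrib]
  rw [add_comm]
  congr 1
  symm
  have h1 : ∑ v ∈ U with v.ord ≠ 0, mulGen v.raise (pd (σ v) f) u =
      ∑ v ∈ (U.filter fun v => v.ord ≠ 0) with v.raise ∈ u, mulGen v.raise (pd (σ v) f) u := by
    refine (Finset.sum_subset (Finset.filter_subset _ _) fun v hv hv' => ?_).symm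
    exact mulGen_apply_of_notMem (fun e => hv' (Finset.mem_filter.2 ⟨hv, e⟩)) _
  have h2 : ∑ v ∈ U with v.ord ≠ 0,
        mulGen v (if (σ v).ord = 0 then 0 else pd (σ v).lower f) u =
      ∑ v ∈ (U.filter fun v => v.ord ≠ 0) with v ∈ u ∧ v.ord ≠ 1,
        mulGen v (if (σ v).ord = 0 then 0 else pd (σ v).lower f) u := by
    refine (Finset.sum_subset (Finset.filter_subset _ _) fun v hv hv' => ?_).symm
    have hv3 := (Finset.mem_filter.1 hv).2
    by_cases hvu : v ∈ u
    · have : v.ord = 1 := by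
        by_contra h
        exact hv' (Finset.mem_filter.2 ⟨hv, hvu, h⟩)
      have h0 : (σ v).ord = 0 := by simp [σ, this]
      rw [if_pos h0]
      simp [mulGen]
    · exact mulGen_apply_of_notMem hvu _
  refine h1.trans (Eq.trans ?_ h2.symm)
  refine Finset.sum_bij' (fun v _ => v.raise) (fun v _ => v.lower) ?_ ?_ ?_ ?_ ?_
  · intro v hv
    simp only [Finset.mem_filter] at hv ⊢
    refine ⟨⟨hU hv.2, by simp [Jet.raise]⟩, hv.2, ?_⟩
    simp only [Jet.raise]; omega
  · intro v hv
    simp only [Finset.mem_filter] at hv ⊢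
    refine ⟨⟨hU' v hv.2.1, ?_⟩, ?_⟩
    · simp only [Jet.lower]; omega
    · rw [Jet.raise_lower hv.1.2]; exact hv.2.1
  · intro v _; exact Jet.lower_raise v
  · intro v hv
    exact Jet.raise_lower (Finset.mem_filter.1 (Finset.mem_filter.1 hv).1).2
  · intro v hv
    have hv0 := (Finset.mem_filter.1 (Finset.mem_filter.1 hv).1).2
    have : ¬ (v.raise.ord - 1 = 0) := by simpa [Jet.raise] using hv0
    rw [if_neg this]
    rfl

/-- All monomials of `f` contain at least `M` derivatives. -/
def Low (M : ℕ) (f : Density N) : Prop :=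
  ∀ u n, weight u n < M → coeff n (f u) = 0

theorem weight_add_single (u : Finset (Jet N)) (n : Jet N →₀ ℕ) (v : Jet N) :
    weight u (n + Finsupp.single v 1) = weight u n + v.ord := by
  unfold weight
  rw [Finsupp.sum_add_index' (by simp) (by intros; ring), Finsupp.sum_single_index (by simp)]
  ring

theorem weight_insert {u : Finset (Jet N)} {v : Jet N} (h : v ∉ u) (n : Jet N →₀ ℕ) :
    weight (insert v u) n = v.ord + weight u n := by
  unfold weight
  rw [Finset.sum_insert h]
  ring

theorem weight_mono {s u : Finset (Jet N)} (h : s ⊆ u) (a b : Jet N →₀ ℕ) :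
    weight s a ≤ weight u (a + b) := by
  unfold weight
  rw [Finsupp.sum_add_index' (by simp) (by intros; ring)]
  have := Finset.sum_le_sum_of_subset (f := fun v : Jet N => v.ord) h
  omega

theorem low_totalDeriv {M : ℕ} {f : Density N} (hf : Low M f) : Low (M + 1) (totalDeriv f) := by
  intro u n hw
  rw [totalDeriv_apply, map_add, coeff_evenTotalDeriv subset_rfl,
    oddTotalDeriv_apply subset_rfl, map_sum, Finset.sum_eq_zero, Finset.sum_eq_zero, add_zero]
  · intro v hv
    obtain ⟨hvu, hv0⟩ := Finset.mem_filter.1 hv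
    have hlow : v.lower.ord + 1 = v.ord := by simp only [Jet.lower]; omega
    have hu := weight_insert (Finset.notMem_erase v u) n
    rw [Finset.insert_erase hvu] at hu
    simp only [mulGen, contract, if_pos hvu]
    split_ifs with h
    · simp
    · rw [← zsmul_eq_mul, ← zsmul_eq_mul, map_zsmul, map_zsmul, hf, smul_zero, smul_zero]
      rw [weight_insert h]
      omega
  · intro v hv
    obtain ⟨hvn, hv0⟩ := Finset.mem_filter.1 hv
    have hlow : v.lower.ord + 1 = v.ord := by simp only [Jet.lower]; omega
    obtain ⟨n, rfl⟩ : ∃ n', n = n' + Finsupp.single v 1 := by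
      refine ⟨n - Finsupp.single v 1, (tsub_add_cancel_of_le ?_).symm⟩
      rw [Finsupp.single_le_iff]
      exact Nat.one_le_iff_ne_zero.2 (Finsupp.mem_support_iff.1 hvn)
    rw [weight_add_single] at hw
    rw [add_comm, X, coeff_add_monomial_mul, _root_.one_mul, coeff_pderiv, hf, zero_mul]
    rw [weight_add_single]
    omega

theorem low_mul {M : ℕ} {f : Density N} (hf : Low M f) (h : Density N) : Low M (f * h) := by
  intro u n hw
  rw [mul_apply, map_sum]
  refine Finset.sum_eq_zero fun s hs => ?_
  rw [← zsmul_eq_mul, map_zsmul, coeff_mul, Finset.sum_eq_zero, smul_zero]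
  intro p hp
  have := weight_mono (Finset.mem_powerset.1 hs) p.1 p.2
  rw [Finset.HasAntidiagonal.mem_antidiagonal.1 hp] at this
  rw [hf _ _ (this.trans_lt hw), zero_mul]

theorem low_pow {f : Density N} (m : ℕ) : Low m ((totalDeriv ^ m) f) := by
  induction m with
  | zero => intro u n h; omega
  | succ m ih =>
    rw [pow_succ']
    exact low_totalDeriv ih

theorem low_sum {ι : Type*} {M : ℕ} (t : Finset ι) (f : ι → Density N)
    (hf : ∀ i ∈ t, Low M (f i)) : Low M (∑ i ∈ t, f i) := by
  intro u n h
  rw [Grass.sum_apply, map_sum]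
  exact Finset.sum_eq_zero fun i hi => hf i hi u n h

theorem low_jetSum_sub {a : ℕ → Density N} (ha : ∀ m, Low m (a m)) (M : ℕ) :
    Low M (jetSum a - ∑ m ∈ Finset.range M, a m) := by
  intro u n h
  rw [Grass.sub_apply, map_sub, coeff_jetSum, Grass.sum_apply, map_sum, sub_eq_zero]
  refine Finset.sum_subset (Finset.range_subset_range.2 h) fun m _ hm => ?_
  exact ha m u n (by simpa using hm)

theorem varDeriv_totalDeriv (α : Fin N) (f : Density N) : varDeriv α (totalDeriv f) = 0 := by
  have key : ∀ k, ∑ m ∈ Finset.range (k + 1),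
      (-1 : ℂ) ^ m • (totalDeriv ^ m) (pd ⟨α, 0, m⟩ (totalDeriv f)) =
      (-1 : ℂ) ^ k • (totalDeriv ^ (k + 1)) (pd ⟨α, 0, k⟩ f) := by
    intro k
    induction k with
    | zero => simp [pd_totalDeriv]
    | succ k ih =>
      rw [Finset.sum_range_succ, ih, pd_totalDeriv, if_neg (Nat.succ_ne_zero k), map_add,
        pow_succ totalDeriv (k + 1), Module.End.mul_apply, smul_add]
      have : (Jet.lower ⟨α, 0, k + 1⟩ : Jet N) = ⟨α, 0, k⟩ := rfl
      rw [this, pow_succ (-1 : ℂ) k]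
      module
  ext u n
  change coeff n (jetSum _ u) = 0
  rw [coeff_jetSum]
  have h := congrArg (fun k : Density N => coeff n (k u)) (key (weight u n))
  simp only [Grass.sum_apply, map_sum] at h
  rw [h, Grass.smul_apply, map_smul, low_pow _ _ _ (Nat.lt_succ_self _), smul_zero]

theorem hamDeriv_apply (G : Matrix (Fin N) (Fin N) ℂ) (L f : Density N) : hamDeriv G L f =
    jetSum fun m => ∑ β, (totalDeriv ^ m) (hamField G β L) * pd ⟨β, 0, m⟩ f := rfl

theorem hamDeriv_totalDeriv (G : Matrix (Fin N) (Fin N) ℂ) (L f : Density N) :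
    hamDeriv G L (totalDeriv f) = totalDeriv (hamDeriv G L f) := by
  rw [hamDeriv_apply, hamDeriv_apply]
  set V : Fin N → ℕ → Density N := fun β m => (totalDeriv ^ m) (hamField G β L) with hV
  have hV1 : ∀ β m, totalDeriv (V β m) = V β (m + 1) := fun β m => by
    simp only [hV, pow_succ' totalDeriv m, Module.End.mul_apply]
  have hlow : ∀ m (k : Fin N → Density N), Low m (∑ β, V β m * k β) := fun m k =>
    low_sum _ _ fun β _ => low_mul (low_pow m) _
  have key : ∀ M, totalDeriv (∑ m ∈ Finset.range (M + 1), ∑ β, V β m * pd ⟨β, 0, m⟩ f) =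
      ∑ m ∈ Finset.range (M + 1), ∑ β, V β m * pd ⟨β, 0, m⟩ (totalDeriv f) +
      ∑ β, V β (M + 1) * pd ⟨β, 0, M⟩ f := by
    intro M
    induction M with
    | zero =>
      simp only [Finset.sum_range_succ, Finset.sum_range_zero, _root_.zero_add, map_sum,
        totalDeriv_mul, hV1, pd_totalDeriv, if_true, _root_.add_zero, Finset.sum_add_distrib]
      abel
    | succ M ih =>
      rw [Finset.sum_range_succ, map_add, ih, Finset.sum_range_succ _ (M + 1)]
      have : ∀ β, (Jet.lower ⟨β, 0, M + 1⟩ : Jet N) = ⟨β, 0, M⟩ := fun β => rfl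
      simp only [map_sum, totalDeriv_mul, hV1, pd_totalDeriv, if_neg (Nat.succ_ne_zero M),
        this, Grass.mul_add, Finset.sum_add_distrib]
      abel
  ext u n
  have h1 := (low_jetSum_sub (fun m => hlow m fun β => pd ⟨β, 0, m⟩ (totalDeriv f))
    (weight u n + 1)) u n (Nat.lt_succ_self _)
  have h2 := low_totalDeriv (low_jetSum_sub (fun m => hlow m fun β => pd ⟨β, 0, m⟩ f)
    (weight u n + 1)) u n (by omega)
  have h3 := hlow (weight u n + 1) (fun β => pd ⟨β, 0, weight u n⟩ f) u n (Nat.lt_succ_self _)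
  rw [map_sub, key, Grass.sub_apply, Grass.add_apply, map_sub, map_add, h3, _root_.add_zero,
    sub_eq_zero] at h2
  rw [Grass.sub_apply, map_sub, sub_eq_zero] at h1
  exact h1.trans h2.symm

end Density

/-! ### Current observables modulo total derivatives, and their differential and bracket -/

section CurrentObservables

variable {N : ℕ}

/-- The space `Obs^{∮_C}` of current observables `∮_C 𝒥_L^{(1)} = ∮_C dz L`: densities modulo
total `∂_z`-derivatives. The contour integral of a total `∂_z`-derivative vanishes on `∂̄`-closed
fields, see `BCOVField.contour` for the actual integral. -/
abbrev CurrentObs (N : ℕ) : Type :=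
  Density N ⧸ LinearMap.range (Density.totalDeriv (N := N))

/-- The current observable `∮_C 𝒥_L^{(1)}` of a density `L`. -/
noncomputable def current : Density N →ₗ[ℂ] CurrentObs N := Submodule.mkQ _

/-- The differential `∮_C 𝒥_L^{(1)} ↦ ∮_C 𝒥_{δL}^{(1)}` on current observables. -/
noncomputable def currentDelta : CurrentObs N →ₗ[ℂ] CurrentObs N :=
  Submodule.mapQ _ _ Density.delta <| by
    rintro _ ⟨f, rfl⟩
    exact ⟨Density.delta f, (Density.delta_totalDeriv f).symm⟩

/-- The BV bracket `{∫ 𝒥_L^{(2)}, -}_BV` acting on current observables through the derivation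
induced by the Hamiltonian vector field of the local functional `∫ 𝒥_L^{(2)}`. -/
noncomputable def bvAct (G : Matrix (Fin N) (Fin N) ℂ) :
    Density N →ₗ[ℂ] CurrentObs N →ₗ[ℂ] CurrentObs N where
  toFun L := Submodule.mapQ _ _ (Density.hamDeriv G L) <| by
    rintro _ ⟨f, rfl⟩
    exact ⟨Density.hamDeriv G L f, (Density.hamDeriv_totalDeriv G L f).symm⟩
  map_add' L L' := Submodule.linearMap_qext _ <| LinearMap.ext fun f => by
    simp
  map_smul' c L := Submodule.linearMap_qext _ <| LinearMap.ext fun f => by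
    simp

/-- The bracket
`{∮_C 𝒥_L^{(1)}, ∮_C 𝒥_{L'}^{(1)}}_C = {∫ 𝒥_L^{(2)}, ∮_C 𝒥_{L'}^{(1)}}_BV` on current
observables. -/
noncomputable def currentBracket (G : Matrix (Fin N) (Fin N) ℂ) :
    CurrentObs N →ₗ[ℂ] CurrentObs N →ₗ[ℂ] CurrentObs N :=
  Submodule.liftQ _ (bvAct G) <| by
    rintro _ ⟨f, rfl⟩
    have h : ∀ β, Density.hamField G β (Density.totalDeriv f) = 0 := fun β => by
      simp [Density.hamField, Density.varDeriv_totalDeriv]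
    refine Submodule.linearMap_qext _ <| LinearMap.ext fun k => ?_
    have h' : Density.hamDeriv G (Density.totalDeriv f) k = 0 := by
      rw [Density.hamDeriv_apply]
      simp only [h]
      have : ∀ x : Density N, (0 : Density N) * x = 0 := fun x => by
        simpa using Grass.smul_mul (0 : ℂ) (0 : Density N) x
      simp only [map_zero, this, Finset.sum_const_zero]
      simpa using Density.jetSum_smul (0 : ℂ) (fun _ => (0 : Density N))
    simp [bvAct, h']

end CurrentObservables

/-! ### Genus zero correlators and the interaction density -/

/-- Correlation functions on the big phase space `H⟦t⟧ = (ℕ → H)`, for a purely even vector space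
`H` with a chosen basis `𝒪_α`; `unit` is the index of the puncture operator `P`. -/
structure Correlators (N : ℕ) (H : Type*) [AddCommGroup H] [Module ℂ H] where
  basis : Module.Basis (Fin N) ℂ H
  unit : Fin N
  corr : (n : ℕ) → MultilinearMap ℂ (fun _ : Fin n => ℕ → H) ℂ
  corr_symm : ∀ (n : ℕ) (σ : Equiv.Perm (Fin n)) (v : Fin n → ℕ → H), corr n (v ∘ σ) = corr n v

namespace Correlators

variable {N : ℕ} {H : Type*} [AddCommGroup H] [Module ℂ H] (T : Correlators N H)

/-- The gravitational descendant `𝒪_α^{(k)} = t^k 𝒪_α`, for `p = (α, k)`. -/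
noncomputable def descendant (p : Fin N × ℕ) : ℕ → H := Pi.single p.2 (T.basis p.1)

/-- The correlator `⟨𝒪_{α_1}^{(k_1)} ⋯ 𝒪_{α_n}^{(k_n)}⟩_0` of a list of indices `(α_i, k_i)`. -/
noncomputable def bracket (l : List (Fin N × ℕ)) : ℂ := T.corr l.length fun i => T.descendant (l.get i)

/-- The formal power series
`⟪𝒪_{α_1}^{(k_1)} ⋯⟫_0(b) = ⟨𝒪_{α_1}^{(k_1)} ⋯ exp (∑ b^α_k 𝒪_α^{(k)})⟩_0` in the
coordinates `b^α_k` of the big phase space. -/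
noncomputable def bigBracket (l : List (Fin N × ℕ)) : MvPowerSeries (Fin N × ℕ) ℂ :=
  fun n => (n.prod fun _ e => (e.factorial : ℂ))⁻¹ * T.bracket (l ++ (Finsupp.toMultiset n).toList)

/-- `g_{αβ} = ⟨𝒪_α 𝒪_β P⟩_0`. -/
noncomputable def metric : Matrix (Fin N) (Fin N) ℂ :=
  Matrix.of fun α β => T.bracket [(α, 0), (β, 0), (T.unit, 0)]

end Correlators

/-- Genus zero data of a 2d topological field theory: correlators requiring at least three
insertions, with non-degenerate metric, that satisfy the topological recursion relation. -/
structure GenusZeroTFT (N : ℕ) (H : Type*) [AddCommGroup H] [Module ℂ H] extends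
    Correlators N H where
  corr_of_lt : ∀ n < 3, corr n = 0
  metric_isUnit : IsUnit toCorrelators.metric.det
  trr : ∀ (i j k : ℕ) (α β γ : Fin N),
    toCorrelators.bigBracket [(α, i + 1), (β, j), (γ, k)] =
      ∑ σ, ∑ τ, toCorrelators.metric⁻¹ σ τ •
        (toCorrelators.bigBracket [(α, i), (σ, 0)] *
          toCorrelators.bigBracket [(τ, 0), (β, j), (γ, k)])

/-- The symbols without derivatives, indexed by `(α, k)`. -/
def Jet.base {N : ℕ} (p : Fin N × ℕ) : Jet N := ⟨p.1, p.2, 0⟩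

instance Jet.tendstoCofinite_base {N : ℕ} : Filter.TendstoCofinite (Jet.base (N := N)) :=
  Filter.tendstoCofinite_of_injective fun p q h => by
    simp only [Jet.base, Jet.mk.injEq] at h
    exact Prod.ext h.1 h.2.1

/-- The interaction density
`ℒ^H = ∑_{k,α} ρ^α_k ⟨𝒪_α^{(k)} exp (∑ λ^β_m 𝒪_β^{(m)})⟩_0`. -/
noncomputable def Correlators.density {N : ℕ} {H : Type*} [AddCommGroup H] [Module ℂ H]
    (T : Correlators N H) : Density N :=
  fun u => ∑ᶠ p : Fin N × ℕ, Grass.mulGen (Jet.base p)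
    (fun s => if s = ∅ then MvPowerSeries.rename Jet.base (T.bigBracket [p]) else 0) u

/-! ### Fields on the cylinder `ℂ/ℤ` and contour integrals -/

/-- `∂_z = (∂_x - i ∂_y) / 2` on functions of `z = x + i y`. -/
noncomputable def wirtinger (f : ℂ → ℂ) : ℂ → ℂ :=
  fun z => (fderiv ℝ f z 1 - Complex.I * fderiv ℝ f z Complex.I) / 2

/-- `∂_z̄ = (∂_x + i ∂_y) / 2` on functions of `z = x + i y`. -/
noncomputable def wirtingerBar (f : ℂ → ℂ) : ℂ → ℂ :=
  fun z => (fderiv ℝ f z 1 + Complex.I * fderiv ℝ f z Complex.I) / 2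

/-- Elements of `Ω^{0,•} ⊗ Λ` over `ℂ/ℤ`, with `Λ` the Grassmann algebra on `q` auxiliary odd
parameters: coefficients are functions of `z`, the generator `0` is `dz̄`, the generators
`1, …, q` are the parameters. -/
abbrev SuperForm (q : ℕ) : Type := Grass (Fin (q + 1)) (ℂ → ℂ)

/-- `∂_z`, acting on coefficients. -/
noncomputable def SuperForm.dz {q : ℕ} (f : SuperForm q) : SuperForm q :=
  fun s => wirtinger (f s)

/-- `∂̄ = dz̄ ∂_z̄`. -/
noncomputable def SuperForm.dbar {q : ℕ} (f : SuperForm q) : SuperForm q :=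
  Grass.mulGen 0 fun s => wirtingerBar (f s)

/-- A field `μ = ∑ (λ^α_k 𝒪_α t^k + ρ^α_k ∂_z 𝒪_α t^k)` of the `H`-valued BCOV theory on
`ℂ^× = ℂ/ℤ`, of total even degree, depending on `q` auxiliary odd parameters (a `Λ`-point of the
graded space of fields, in the formal neighbourhood of `0`): the components are smooth
`1`-periodic `Λ`-valued `(0,•)`-forms, `λ^α_k` is even and `ρ^α_k` is odd, almost all of
them vanish, and `λ^α_k` vanishes when the parameters and `dz̄` are set to `0`. -/
structure BCOVField (N q : ℕ) where
  lam : Fin N → ℕ → SuperForm q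
  rho : Fin N → ℕ → SuperForm q
  lam_smooth : ∀ α k s, ContDiff ℝ (⊤ : ℕ∞) (lam α k s)
  rho_smooth : ∀ α k s, ContDiff ℝ (⊤ : ℕ∞) (rho α k s)
  lam_periodic : ∀ α k s z, lam α k s (z + 1) = lam α k s z
  rho_periodic : ∀ α k s z, rho α k s (z + 1) = rho α k s z
  lam_even : ∀ α k s, Odd s.card → lam α k s = 0
  rho_odd : ∀ α k s, Even s.card → rho α k s = 0
  lam_formal : ∀ α k, lam α k ∅ = 0
  finite : ∃ K, ∀ α, ∀ k ≥ K, lam α k = 0 ∧ rho α k = 0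

namespace BCOVField

variable {N q : ℕ} (φ : BCOVField N q)

/-- The field is `∂̄`-closed. -/
def DbarClosed : Prop :=
  ∀ α k, (φ.lam α k).dbar = 0 ∧ (φ.rho α k).dbar = 0

/-- The value `∂_z^m λ^α_k` at the field. -/
noncomputable def lamJet (g : Jet N) : SuperForm q := SuperForm.dz^[g.ord] (φ.lam g.idx g.lvl)

/-- The value `∂_z^m ρ^α_k` at the field. -/
noncomputable def rhoJet (g : Jet N) : SuperForm q := SuperForm.dz^[g.ord] (φ.rho g.idx g.lvl)

/-- The value of the monomial `λ^n ρ_u` at the field. -/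
noncomputable def monomial (u : Finset (Jet N)) (n : Jet N →₀ ℕ) : SuperForm q :=
  (((Finsupp.toMultiset n).sort).map φ.lamJet).prod * ((u.sort).map φ.rhoJet).prod

/-- The `(0,•)`-form `L(∂_z^m λ^α_k, ∂_z^m ρ^α_k)` at the field, so that `𝒥_L = dz L`. -/
noncomputable def eval (L : Density N) : SuperForm q :=
  fun s z => ∑ᶠ p : Finset (Jet N) × (Jet N →₀ ℕ),
    MvPowerSeries.coeff p.2 (L p.1) * φ.monomial p.1 p.2 s z

/-- The value of `∮_C 𝒥_L^{(1)}` at the field, `C = {z ∈ [0,1]}`: the integral of the part of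
`dz L` without `dz̄`, an element of the Grassmann algebra `Λ`. -/
noncomputable def contour (L : Density N) : Grass (Fin q) ℂ :=
  fun s => ∫ x in (0 : ℝ)..1, φ.eval L (s.map (Fin.succEmb q)) (x : ℂ)

end BCOVField

/-! ### Genus zero correlators -/

namespace Correlators

variable {N : ℕ} {H : Type*} [AddCommGroup H] [Module ℂ H] (T : Correlators N H)

/-! Write `p = (α, k)` and `p + 1 = (α, k + 1)`, and put `B(p,q) = ⟪𝒪_p 𝒪_q⟫₀(λ)` and `A(p,q) = B(p
+ 1, q)`. A derivative of a correlator inserts one more operator, so topological recursion says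
`dA(p,q) = ∑ g^{στ} B(p,σ) dB(τ,q)`. Adding the relation with `p` and `q` exchanged makes the right
side an exact differential. Two-point correlators at the origin vanish, so no integration constant
appears and `A(p,q) + A(q,p) = ∑ g^{στ} B(p,σ) B(q,τ)` (`pairing_succ_add_pairing_succ`). The chain
rule on the unintegrated relation gives `∂A(p,q) = ∑ g^{στ} B(p,σ) ∂B(q,τ)`
(`evenTotalDeriv_pairing_succ`).

The density contains no derivatives of the symbols. Hence `δL = ∑ ∂ρ_p ρ_q A(p,q)`, and variational
derivatives with respect to `λ_0` are plain partial derivatives. In `δ_L L = -∑ g^{αβ} ∂(∑ ρ_p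
B(p,α)) (∑ ρ_q B(q,β))` the derivative falls on `ρ_p`, which gives `-∑ ∂ρ_p ρ_q (A(p,q) + A(q,p))`,
or on `B`, which gives `∑ ρ_p ρ_q ∂A(p,q)` once anticommutation is used. Therefore `δL + ½ δ_L L` is
exactly `∂_z` of `½ ∑ ρ_p ρ_q A(p,q)`; this is `delta_add_half_hamDeriv`, and the equation modulo
total derivatives follows. The sums over `p` and `q` are infinite, but each odd degree sees finitely
many terms, so the computation is done for finite index sets in `maurerCartan_finite`.

For honest integrals the same identity is evaluated at a field. Only levels below some `K` occur,
and a product of more than `q + 1` of the nilpotent `λ`'s vanishes, so only the "relevant" monomials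
matter. The densities involved have finitely many of these, because the number of derivatives in
them is bounded. On finite sums of monomials, evaluation intertwines `totalDeriv` with `∂_z`
(`compatible_of_mem_poly`). For a `∂̄`-closed field the components without `dz̄` are holomorphic and
periodic, so the integral of a `∂_z`-derivative over one period is zero. -/

theorem bracket_perm {l l' : List (Fin N × ℕ)} (h : l.Perm l') : T.bracket l = T.bracket l' := by
  classical
  have hn : l'.length = l.length := h.length_eq.symm
  have hget : ∀ i : Fin l.length, l'.get (h.idxBij i) = l.get i := fun i => by
    simp only [List.get_eq_getElem, h.getElem_idxBij_eq_getElem]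
  let σ : Equiv.Perm (Fin l.length) :=
    (Equiv.ofBijective h.idxBij ⟨h.idxBij_injective, h.idxBij_surjective⟩).trans (finCongr hn)
  have key : ∀ (n : ℕ) (e : l'.length = n),
      T.bracket l' = T.corr n fun i => T.descendant (l'.get (Fin.cast e.symm i)) := by
    rintro n rfl; rfl
  rw [key _ hn, ← T.corr_symm _ σ]
  refine congrArg _ (funext fun i => congrArg _ ?_)
  exact (hget i).symm

theorem bigBracket_perm {l l' : List (Fin N × ℕ)} (h : l.Perm l') :
    T.bigBracket l = T.bigBracket l' :=
  funext fun _ => congrArg _ (T.bracket_perm (h.append_right _))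

theorem coeff_bigBracket (l : List (Fin N × ℕ)) (n : Fin N × ℕ →₀ ℕ) :
    MvPowerSeries.coeff n (T.bigBracket l) = (n.prod fun _ e => (e.factorial : ℂ))⁻¹ *
      T.bracket (l ++ (Finsupp.toMultiset n).toList) := rfl

/-- Differentiating the exponential brings down one insertion. On coefficients, the factor `n r + 1`
from the derivative cancels the growth of the factorial, and symmetry of the correlators moves the
new insertion out of the multiset. -/
theorem pderiv_bigBracket (r : Fin N × ℕ) (l : List (Fin N × ℕ)) :
    MvPowerSeries.pderiv ℂ r (T.bigBracket l) = T.bigBracket (l ++ [r]) := by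
  ext n
  rw [MvPowerSeries.coeff_pderiv, coeff_bigBracket, coeff_bigBracket]
  have h1 : T.bracket (l ++ (Finsupp.toMultiset (n + Finsupp.single r 1)).toList) =
      T.bracket (l ++ [r] ++ (Finsupp.toMultiset n).toList) := by
    refine T.bracket_perm ?_
    rw [List.append_assoc]
    refine List.Perm.append_left l (Multiset.coe_eq_coe.1 ?_)
    simp [Finsupp.toMultiset_add, ← Multiset.singleton_add, add_comm, ← Multiset.cons_coe]
  have h2 : ((n + Finsupp.single r 1).prod fun _ e => (e.factorial : ℂ)) =
      (n.prod fun _ e => (e.factorial : ℂ)) * (n r + 1) := by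
    classical
    have hs : (n + Finsupp.single r 1).support ⊆ insert r n.support := by
      intro y hy
      by_cases h : y = r
      · simp [h]
      · simpa [h, Finsupp.single_eq_of_ne h] using hy
    rw [Finsupp.prod_of_support_subset _ hs _ (by simp),
      Finsupp.prod_of_support_subset _ (Finset.subset_insert r n.support) _ (by simp),
      ← Finset.mul_prod_erase _ _ (Finset.mem_insert_self r n.support),
      ← Finset.mul_prod_erase _ (fun a => ((n a).factorial : ℂ))
        (Finset.mem_insert_self r n.support)]
    have : ∀ a ∈ (insert r n.support).erase r,
        (((n + Finsupp.single r 1 : Fin N × ℕ →₀ ℕ) a).factorial : ℂ) = (n a).factorial :=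
      fun a ha => by simp [Finsupp.single_eq_of_ne (Finset.ne_of_mem_erase ha)]
    rw [Finset.prod_congr rfl this]
    simp only [Finsupp.add_apply, Finsupp.single_eq_same, Nat.factorial_succ]
    push_cast; ring
  have h3 : (n r + 1 : ℂ) ≠ 0 := by exact_mod_cast Nat.succ_ne_zero (n r)
  rw [h1, h2, mul_inv]
  field_simp

theorem metric_isSymm : T.metric.IsSymm :=
  Matrix.ext fun _ _ => T.bracket_perm (List.Perm.swap _ _ _)

end Correlators

/-! ### Integrating the topological recursion relation. -/

namespace GenusZeroTFT

variable {N : ℕ} {H : Type*} [AddCommGroup H] [Module ℂ H] (T : GenusZeroTFT N H)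

/-- The constant term is a correlator with two insertions, which is unstable in genus zero. This
fixes the integration constant below. -/
theorem constantCoeff_bigBracket_pair (p q : Fin N × ℕ) :
    MvPowerSeries.constantCoeff (T.bigBracket [p, q]) = 0 := by
  rw [← MvPowerSeries.coeff_zero_eq_constantCoeff_apply, Correlators.coeff_bigBracket]
  simp [Correlators.bracket, T.corr_of_lt]

/-- The recursion relation itself, with its third insertion read as a derivative: a formula for the
differential of a two-point function. -/
theorem pderiv_bigBracket_succ (p q r : Fin N × ℕ) :
    MvPowerSeries.pderiv ℂ r (T.bigBracket [(p.1, p.2 + 1), q]) =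
      ∑ σ, ∑ τ, T.metric⁻¹ σ τ •
        (T.bigBracket [p, (σ, 0)] * MvPowerSeries.pderiv ℂ r (T.bigBracket [(τ, 0), q])) := by
  simp only [T.pderiv_bigBracket]
  exact T.trr _ _ _ _ _ _

theorem metric_inv_symm (σ τ : Fin N) : T.metric⁻¹ σ τ = T.metric⁻¹ τ σ :=
  T.metric_isSymm.inv.apply τ σ

/-- The integrated form of the topological recursion relation. -/
theorem bigBracket_succ_add_bigBracket_succ (p q : Fin N × ℕ) :
    T.bigBracket [(p.1, p.2 + 1), q] + T.bigBracket [(q.1, q.2 + 1), p] =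
      ∑ σ, ∑ τ, T.metric⁻¹ σ τ • (T.bigBracket [p, (σ, 0)] * T.bigBracket [(τ, 0), q]) := by
  have hswap : ∀ a b, T.bigBracket [a, b] = T.bigBracket [b, a] := fun a b =>
    T.bigBracket_perm (List.Perm.swap _ _ _)
  -- Over `ℂ` a power series is determined by its first partial derivatives and its constant term.
  refine MvPowerSeries.pderiv.ext (fun r => ?_) ?_
  · rw [map_add, pderiv_bigBracket_succ, pderiv_bigBracket_succ]
    -- With `σ` and `τ` exchanged and `g` symmetric, the second recursion supplies the other half of
    -- the Leibniz rule for the product.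
    rw [Finset.sum_comm (f := fun σ τ => T.metric⁻¹ σ τ •
      (T.bigBracket [q, (σ, 0)] * MvPowerSeries.pderiv ℂ r (T.bigBracket [(τ, 0), p])))]
    simp only [map_sum, Derivation.map_smul, Derivation.leibniz, smul_eq_mul, smul_add,
      Finset.sum_add_distrib]
    congr 1
    refine Finset.sum_congr rfl fun σ _ => Finset.sum_congr rfl fun τ _ => ?_
    rw [metric_inv_symm, hswap q, hswap p]
  · simp [constantCoeff_bigBracket_pair, MvPowerSeries.constantCoeff_smul]

end GenusZeroTFT

/-! ### Even series as densities and quadratic odd monomials -/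

namespace Grass

variable {Y R : Type*} [LinearOrder Y] [CommRing R]

/-- The inclusion of the coefficient ring. -/
def const (F : R) : Grass Y R := fun s => if s = ∅ then F else 0

theorem const_apply (F : R) (s : Finset Y) : (const F : Grass Y R) s = if s = ∅ then F else 0 := rfl

theorem const_mul_apply (F : R) (f : Grass Y R) (u : Finset Y) :
    (const F * f : Grass Y R) u = F * f u := by
  rw [mul_apply, Finset.sum_eq_single ∅]
  · simp [const_apply, sgn]
  · intro s _ hs
    simp [const_apply, hs]
  · simp

theorem const_mul_const (F G : R) : (const F * const G : Grass Y R) = const (F * G) := by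
  ext u
  rw [const_mul_apply, const_apply, const_apply]
  split_ifs <;> simp

theorem inv_const (F : R) : inv (const F : Grass Y R) = const F := by
  ext u
  simp only [inv, const_apply]
  split_ifs with h <;> simp [h]

theorem const_mul_mulGen (F : R) (v : Y) (f : Grass Y R) :
    const F * mulGen v f = mulGen v (const F * f) := by
  rw [mul_mulGen, inv_const]

theorem neg_mul (f h : Grass Y R) : (-f) * h = -(f * h) := by
  ext u
  simp [mul_apply]

theorem mulGen_neg (v : Y) (f : Grass Y R) : mulGen v (-f) = -mulGen v f := by
  ext u
  simp only [mulGen, neg_apply]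
  split_ifs <;> simp

theorem inv_mulGen (v : Y) (f : Grass Y R) : inv (mulGen v f) = -mulGen v (inv f) := by
  ext u
  simp only [inv, mulGen, neg_apply]
  split_ifs with h
  · rw [← Finset.card_erase_add_one h]
    ring
  · simp

theorem mulGen_one_mul (v : Y) (f : Grass Y R) : mulGen v 1 * f = mulGen v f := by
  rw [← mulGen_mul, one_mul]

/-- Moving one generator past the other applies the parity involution to a generator, which produces
the sign. -/
theorem mulGen_mulGen (v w : Y) (f : Grass Y R) :
    mulGen v (mulGen w f) = -mulGen w (mulGen v f) := by
  have h1 : inv (1 : Grass Y R) = 1 := inv_const 1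
  rw [← mulGen_one_mul v, mul_mulGen, inv_mulGen, neg_mul, h1, mulGen_one_mul, mulGen_neg]

/-- A component along `θ_u` depends only on components along subsets of `u`. This locality permits
infinite odd sums to be replaced by finite ones, degree by degree. -/
theorem mul_congr {f f' h h' : Grass Y R} {u : Finset Y} (hf : ∀ s ⊆ u, f s = f' s)
    (hh : ∀ s ⊆ u, h s = h' s) : (f * h) u = (f' * h') u := by
  rw [mul_apply, mul_apply]
  refine Finset.sum_congr rfl fun s hs => ?_
  rw [hf s (Finset.mem_powerset.1 hs), hh _ Finset.sdiff_subset]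

theorem mulGen_congr {f f' : Grass Y R} {u : Finset Y} (hf : ∀ s ⊆ u, f s = f' s) (v : Y) :
    mulGen v f u = mulGen v f' u := by
  simp only [mulGen, hf _ (Finset.erase_subset _ _)]

theorem mulGen_zero (v : Y) : mulGen v (0 : Grass Y R) = 0 := by
  ext u
  simp [mulGen]

theorem mulGen_sum {ι : Type*} (v : Y) (t : Finset ι) (f : ι → Grass Y R) :
    mulGen v (∑ i ∈ t, f i) = ∑ i ∈ t, mulGen v (f i) :=
  map_sum (⟨⟨mulGen v, mulGen_zero v⟩, mulGen_add v⟩ : Grass Y R →+ Grass Y R) f t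

theorem zero_mul (f : Grass Y R) : 0 * f = 0 := by
  ext u
  simp [mul_apply]

theorem mul_zero (f : Grass Y R) : f * 0 = 0 := by
  ext u
  simp [mul_apply]

theorem sum_mul {ι : Type*} (t : Finset ι) (f : ι → Grass Y R) (h : Grass Y R) :
    (∑ i ∈ t, f i) * h = ∑ i ∈ t, f i * h :=
  map_sum (⟨⟨(· * h), zero_mul h⟩, fun a b => add_mul a b h⟩ : Grass Y R →+ Grass Y R) f t

theorem mul_sum {ι : Type*} (t : Finset ι) (f : ι → Grass Y R) (h : Grass Y R) :
    h * (∑ i ∈ t, f i) = ∑ i ∈ t, h * f i :=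
  map_sum (⟨⟨(h * ·), mul_zero h⟩, fun a b => mul_add a b h⟩ : Grass Y R →+ Grass Y R) f t

end Grass

namespace Density

open MvPowerSeries Grass

variable {N : ℕ}

theorem _root_.Jet.base_injective : Function.Injective (Jet.base (N := N)) := fun p q h => by
  simp only [Jet.base, Jet.mk.injEq] at h
  exact Prod.ext h.1 h.2.1

theorem pd_const (x : Jet N) (F : EvenSeries N) : pd x (const F) = const (pderiv ℂ x F) := by
  ext1 u
  rw [pd_apply, const_apply, const_apply]
  split_ifs
  · rfl
  · exact map_zero _

theorem totalDeriv_const (F : EvenSeries N) :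
    totalDeriv (const F) = const (evenTotalDeriv F) := by
  ext1 u
  have h : ∀ w : Jet N, contract w (const F : Density N) = 0 := fun w => by
    ext1 s
    simp only [contract, const_apply, if_neg (Finset.insert_ne_empty _ _)]
    split_ifs <;> simp
  have h2 : oddTotalDeriv (const F) u = 0 := by
    rw [oddTotalDeriv_apply subset_rfl]
    simp [h, mulGen_zero]
  rw [totalDeriv_apply, h2, _root_.add_zero, const_apply, const_apply]
  split_ifs
  · rfl
  · exact map_zero _

/-- If `dF = ∑ c_i dG_i` then `∂_z F = ∑ c_i ∂_z G_i`. -/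
theorem evenTotalDeriv_eq_sum {ι : Type*} (t : Finset ι) {F : EvenSeries N}
    {c G : ι → EvenSeries N} (h : ∀ x, pderiv ℂ x F = ∑ i ∈ t, c i * pderiv ℂ x (G i)) :
    evenTotalDeriv F = ∑ i ∈ t, c i * evenTotalDeriv (G i) := by
  ext n
  have e2 : ∀ p ∈ Finset.HasAntidiagonal.antidiagonal n, p.2.support ⊆ n.support := fun p hp => by
    rw [← Finset.HasAntidiagonal.mem_antidiagonal.1 hp]
    intro x hx
    simp only [Finsupp.mem_support_iff, Finsupp.add_apply] at hx ⊢
    omega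
  -- The range of summation in `evenTotalDeriv` depends on the degree. Enlarging it to `n.support`
  -- for every part of the antidiagonal makes it constant, so that the sums can be exchanged.
  have h2 : ∀ i, coeff n (c i * evenTotalDeriv (G i)) =
      ∑ v ∈ n.support with v.ord ≠ 0, coeff n (c i * (X v * pderiv ℂ v.lower (G i))) := fun i => by
    simp only [coeff_mul n (c i)]
    rw [Finset.sum_comm]
    refine Finset.sum_congr rfl fun p hp => ?_
    rw [coeff_evenTotalDeriv (e2 p hp), Finset.mul_sum]
  rw [map_sum, Finset.sum_congr rfl fun i _ => h2 i, coeff_evenTotalDeriv subset_rfl,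
    Finset.sum_comm]
  refine Finset.sum_congr rfl fun v _ => ?_
  rw [h, Finset.mul_sum, map_sum]
  exact Finset.sum_congr rfl fun i _ => by rw [mul_left_comm]

-- Renaming is injective with image the symbols of order zero: an exponent that uses a
-- differentiated symbol is never hit, and any other comes from exactly one exponent.
open Classical in
theorem coeff_rename_base (F : MvPowerSeries (Fin N × ℕ) ℂ) (n : Jet N →₀ ℕ) :
    coeff n (rename Jet.base F) =
      if ∀ v, v.ord ≠ 0 → n v = 0 then
        F (n.comapDomain Jet.base Jet.base_injective.injOn) else 0 := by
  let e : Fin N × ℕ ↪ Jet N := ⟨Jet.base, Jet.base_injective⟩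
  split_ifs with h
  · have hn : n = Finsupp.embDomain e (n.comapDomain Jet.base Jet.base_injective.injOn) := by
      ext v
      by_cases hv : v.ord = 0
      · obtain ⟨a, k, m⟩ := v
        obtain rfl : m = 0 := hv
        exact (Finsupp.embDomain_apply_self e (n.comapDomain Jet.base Jet.base_injective.injOn) (a, k)).symm
      · rw [h v hv, Finsupp.embDomain_of_notMem_range]
        rintro ⟨p, rfl⟩
        exact hv rfl
    conv_lhs => rw [hn]
    exact coeff_embDomain_rename e F _
  · refine coeff_rename_eq_zero Jet.base F ?_
    rintro ⟨x, rfl⟩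
    refine h fun v hv => Finsupp.mapDomain_of_notMem_range x v ?_
    rintro ⟨p, rfl⟩
    exact hv rfl

theorem pderiv_rename_base (p : Fin N × ℕ) (F : MvPowerSeries (Fin N × ℕ) ℂ) :
    pderiv ℂ (Jet.base p) (rename Jet.base F) = rename Jet.base (pderiv ℂ p F) := by
  classical
  ext n
  rw [coeff_pderiv, coeff_rename_base, coeff_rename_base]
  have h1 : (∀ v : Jet N, v.ord ≠ 0 → (n + Finsupp.single (Jet.base p) 1 : Jet N →₀ ℕ) v = 0) ↔
      ∀ v : Jet N, v.ord ≠ 0 → n v = 0 := by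
    refine forall₂_congr fun v hv => ?_
    have : v ≠ Jet.base p := fun e => hv (e ▸ rfl)
    simp [Finsupp.single_eq_of_ne this]
  simp only [h1]
  split_ifs
  · rw [← coeff_apply (pderiv ℂ p F), coeff_pderiv]
    have h2 : (n + Finsupp.single (Jet.base p) 1).comapDomain Jet.base Jet.base_injective.injOn =
        n.comapDomain Jet.base Jet.base_injective.injOn + Finsupp.single p 1 := by
      ext q
      by_cases h : q = p
      · simp [h]
      · simp [Finsupp.single_eq_of_ne h, Finsupp.single_eq_of_ne (fun e => h (Jet.base_injective e))]
    rw [h2]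
    rfl
  · simp

theorem pderiv_rename_base_of_ord_ne_zero {x : Jet N} (hx : x.ord ≠ 0)
    (F : MvPowerSeries (Fin N × ℕ) ℂ) : pderiv ℂ x (rename Jet.base F) = 0 := by
  classical
  ext n
  rw [coeff_pderiv, coeff_rename_base, if_neg, MulZeroClass.zero_mul, map_zero]
  intro h
  have := h x hx
  simp at this

/-- The odd quadratic density `θ_v θ_w F`. -/
noncomputable def quad (v w : Jet N) : EvenSeries N →ₗ[ℂ] Density N where
  toFun F := mulGen v (mulGen w (const F))
  map_add' F G := by
    rw [← mulGen_add, ← mulGen_add]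
    congr 2
    ext1 u
    simp only [const_apply, Grass.add_apply]
    split_ifs <;> simp
  map_smul' c F := by
    rw [RingHom.id_apply, ← mulGen_smul, ← mulGen_smul]
    congr 2
    ext1 u
    simp only [const_apply, Grass.smul_apply]
    split_ifs <;> simp

theorem quad_apply (v w : Jet N) (F : EvenSeries N) :
    quad v w F = mulGen v (mulGen w (const F)) := rfl

theorem quad_swap (v w : Jet N) (F : EvenSeries N) : quad v w F = -quad w v F :=
  mulGen_mulGen v w _

theorem mulGen_const_mul_mulGen_const (v w : Jet N) (F G : EvenSeries N) :
    mulGen v (const F) * mulGen w (const G) = quad v w (F * G) := by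
  rw [← mulGen_mul, const_mul_mulGen, const_mul_const, quad_apply]

/-- There are no signs, because the total derivative is an even derivation. -/
theorem totalDeriv_quad (v w : Jet N) (F : EvenSeries N) :
    totalDeriv (quad v w F) =
      quad v.raise w F + quad v w.raise F + quad v w (evenTotalDeriv F) := by
  simp only [quad_apply, totalDeriv_mulGen, totalDeriv_const, mulGen_add]
  abel

/-! ### Sums over the odd symbols without derivatives -/

/-- The sum `∑_{k,α} ρ^α_k a^α_k`. -/
noncomputable def oddSum (a : Fin N × ℕ → Density N) : Density N :=
  fun u => ∑ᶠ p, mulGen (Jet.base p) (a p) u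

/-- Each summand carries its own `ρ_p`, so only those `p` with `ρ_p` in `u` contribute. Any finite
set containing them gives the same component; the freedom in `P` lets one set serve several sums at
once. -/
theorem oddSum_apply (a : Fin N × ℕ → Density N) {u : Finset (Jet N)}
    {P : Finset (Fin N × ℕ)} (h : ∀ p, Jet.base p ∈ u → p ∈ P) :
    oddSum a u = (∑ p ∈ P, mulGen (Jet.base p) (a p)) u := by
  rw [Grass.sum_apply]
  refine finsum_eq_sum_of_support_subset _ fun p hp => h p ?_
  by_contra hpu
  exact hp (mulGen_apply_of_notMem hpu _)

theorem pd_oddSum (x : Jet N) (a : Fin N × ℕ → Density N) :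
    pd x (oddSum a) = oddSum fun p => pd x (a p) := by
  ext1 u
  have h : ∀ p, Jet.base p ∈ u → p ∈ u.image fun v => (v.idx, v.lvl) := fun p hp =>
    Finset.mem_image.2 ⟨_, hp, rfl⟩
  rw [pd_apply, oddSum_apply a h, ← pd_apply, map_sum, oddSum_apply _ h]
  simp only [pd_mulGen]

theorem jetSum_eq_zeroth {a : ℕ → Density N} (h : ∀ m, a (m + 1) = 0) : jetSum a = a 0 := by
  ext u n
  rw [coeff_jetSum, Finset.sum_range_succ']
  simp [h]

/-- Without derivatives of `λ_0` in the density, only the term `m = 0` of the Euler operator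
survives. -/
theorem varDeriv_eq_pd {L : Density N} (h : ∀ α m, pd ⟨α, 0, m + 1⟩ L = 0) (α : Fin N) :
    varDeriv α L = pd ⟨α, 0, 0⟩ L := by
  refine (jetSum_eq_zeroth fun m => ?_).trans ?_
  · rw [h, map_zero, smul_zero]
  · simp

theorem hamDeriv_eq (G : Matrix (Fin N) (Fin N) ℂ) {L f : Density N}
    (hL : ∀ α m, pd ⟨α, 0, m + 1⟩ L = 0) (hf : ∀ α m, pd ⟨α, 0, m + 1⟩ f = 0) :
    hamDeriv G L f =
      -∑ β, ∑ α, G α β • (totalDeriv (pd ⟨α, 0, 0⟩ L) * pd ⟨β, 0, 0⟩ f) := by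
  rw [hamDeriv_apply, jetSum_eq_zeroth fun m => by simp [hf, Grass.mul_zero],
    ← Finset.sum_neg_distrib]
  refine Finset.sum_congr rfl fun β _ => ?_
  simp only [pow_zero, Module.End.one_apply, hamField, LinearMap.neg_apply, LinearMap.sum_apply,
    LinearMap.smul_apply, LinearMap.comp_apply, varDeriv_eq_pd hL, Grass.neg_mul, Grass.sum_mul,
    Grass.smul_mul]

end Density

/-! ### The Maurer–Cartan equation up to an explicit total derivative -/

namespace Correlators

open MvPowerSeries Grass Density

variable {N : ℕ} {H : Type*} [AddCommGroup H] [Module ℂ H] (T : Correlators N H)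

/-- The two-point function `⟪𝒪_p 𝒪_q⟫_0` evaluated at `b = λ`. -/
noncomputable def pairing (p q : Fin N × ℕ) : EvenSeries N :=
  rename Jet.base (T.bigBracket [p, q])

theorem pairing_comm (p q : Fin N × ℕ) : T.pairing p q = T.pairing q p := by
  rw [pairing, T.bigBracket_perm (List.Perm.swap _ _ _), pairing]

theorem density_eq_oddSum :
    T.density = oddSum fun p => const (rename Jet.base (T.bigBracket [p])) := rfl

theorem pd_density (α : Fin N) (k : ℕ) :
    pd ⟨α, k, 0⟩ T.density = oddSum fun p => const (T.pairing p (α, k)) := by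
  rw [density_eq_oddSum, pd_oddSum]
  refine congrArg oddSum (funext fun p => ?_)
  rw [pd_const]
  change const (pderiv ℂ (Jet.base (α, k)) _) = _
  rw [pderiv_rename_base, pderiv_bigBracket]
  rfl

/-- The coefficients are series in undifferentiated `λ`'s. This collapses the variational derivative
and leaves only first-order `ρ`'s in `δL`. -/
theorem pd_density_of_ord_ne_zero {x : Jet N} (hx : x.ord ≠ 0) : pd x T.density = 0 := by
  have h : ∀ p : Fin N × ℕ, mulGen (Jet.base p) (const (0 : EvenSeries N)) = 0 := fun p => by
    rw [show (const (0 : EvenSeries N) : Density N) = 0 from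
      Grass.ext fun s => by simp [const_apply], mulGen_zero]
  rw [density_eq_oddSum, pd_oddSum]
  ext1 u
  simp only [pd_const, pderiv_rename_base_of_ord_ne_zero hx, oddSum, h]
  simp

/-- The density `½ ∑_{p,q} ρ_p ρ_q ⟪𝒪_{p+1} 𝒪_q⟫_0(λ)`. -/
noncomputable def primitive : Density N :=
  (1 / 2 : ℂ) • oddSum fun p => oddSum fun q => const (T.pairing (p.1, p.2 + 1) q)

theorem primitive_apply {u : Finset (Jet N)} {P : Finset (Fin N × ℕ)}
    (h : ∀ p, Jet.base p ∈ u → p ∈ P) : T.primitive u =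
      ((1 / 2 : ℂ) • ∑ p ∈ P, ∑ q ∈ P, quad (Jet.base p) (Jet.base q)
        (T.pairing (p.1, p.2 + 1) q)) u := by
  rw [primitive, Grass.smul_apply, Grass.smul_apply, oddSum_apply _ h, Grass.sum_apply,
    Grass.sum_apply]
  refine congrArg _ (Finset.sum_congr rfl fun p _ => ?_)
  -- The inner infinite sum sits under a product by `ρ_p`, so it has to be made finite on every
  -- subset of `u`.
  rw [mulGen_congr (fun s hs => oddSum_apply _ fun q hq => h q (hs hq)), mulGen_sum]
  rfl

/-- `δ` replaces `∂^(m-1) λ_{k+1}` by `∂^m ρ_k`, and only `m = 1` acts on a density without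
derivatives of `λ`. What remains is `∂ρ_p` times `∂L/∂λ_{p+1} = ∑ ρ_q A(p,q)`. The lowered symbols
enter the condition on `P` so that every `∂ρ_p` in `u` is accounted for. -/
theorem delta_density_apply {u : Finset (Jet N)} {P : Finset (Fin N × ℕ)}
    (h : ∀ p, Jet.base p ∈ u ∪ u.image Jet.lower → p ∈ P) : delta T.density u =
      (∑ p ∈ P, ∑ q ∈ P, quad (Jet.base p).raise (Jet.base q)
        (T.pairing (p.1, p.2 + 1) q)) u := by
  have hu : u ⊆ u ∪ P.image fun p => (Jet.base p).raise := Finset.subset_union_left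
  rw [delta_apply hu, Grass.sum_apply]
  symm
  refine Finset.sum_of_injOn (fun p => (Jet.base p).raise) ?_ ?_ ?_ ?_
  · intro p _ q _ e
    exact Jet.base_injective (congrArg Jet.lower e)
  · intro p hp
    refine Finset.mem_filter.2 ⟨Finset.mem_union_right _ (Finset.mem_image_of_mem _ hp), ?_⟩
    exact Nat.succ_ne_zero _
  -- A symbol that is not some `∂ρ_p` with `p ∈ P` either lies outside `u` or has order at least
  -- two; its term is zero in both cases.
  · intro v hv hv'
    by_cases hvu : v ∈ u
    · rw [T.pd_density_of_ord_ne_zero, mulGen_zero, Grass.zero_apply]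
      intro hord
      have hv0 : v.ord ≠ 0 := (Finset.mem_filter.1 hv).2
      have hb : v.lower = Jet.base (v.idx, v.lvl) := by
        change Jet.mk _ _ (v.ord - 1) = Jet.mk _ _ 0
        rw [show v.ord - 1 = 0 from hord]
      refine hv' ⟨(v.idx, v.lvl), h _ ?_, ?_⟩
      · rw [← hb]
        exact Finset.mem_union_right _ (Finset.mem_image_of_mem _ hvu)
      · change (Jet.base (v.idx, v.lvl)).raise = v
        rw [← hb, Jet.raise_lower hv0]
    · exact mulGen_apply_of_notMem hvu _
  · intro p _
    change _ = mulGen _ (pd ⟨p.1, p.2 + 1, 0⟩ T.density) u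
    rw [T.pd_density, mulGen_congr (fun s hs => oddSum_apply _ fun q hq =>
      h q (Finset.mem_union_left _ (hs hq))), mulGen_sum]
    simp only [T.pairing_comm (p.1, p.2 + 1)]
    rfl

end Correlators

/-! ### The identity exhibiting the Maurer–Cartan expression as a total derivative. -/

namespace GenusZeroTFT

open MvPowerSeries Grass Density

variable {N : ℕ} {H : Type*} [AddCommGroup H] [Module ℂ H] (T : GenusZeroTFT N H)

theorem pairing_succ_add_pairing_succ (p q : Fin N × ℕ) :
    T.pairing (p.1, p.2 + 1) q + T.pairing (q.1, q.2 + 1) p =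
      ∑ σ, ∑ τ, T.metric⁻¹ σ τ • (T.pairing p (σ, 0) * T.pairing q (τ, 0)) := by
  simp only [T.pairing_comm q (_, 0)]
  simp only [Correlators.pairing, ← map_add, bigBracket_succ_add_bigBracket_succ, map_sum,
    map_smul, map_mul]

/-- The chain rule applied to the unintegrated recursion. Only the second factor is differentiated,
which is information that the integrated relation does not contain. -/
theorem evenTotalDeriv_pairing_succ (p q : Fin N × ℕ) :
    evenTotalDeriv (T.pairing (p.1, p.2 + 1) q) = ∑ σ, ∑ τ, T.metric⁻¹ σ τ •
      (T.pairing p (σ, 0) * evenTotalDeriv (T.pairing q (τ, 0))) := by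
  have h := evenTotalDeriv_eq_sum (Finset.univ ×ˢ Finset.univ : Finset (Fin N × Fin N))
    (F := T.pairing (p.1, p.2 + 1) q)
    (c := fun i => T.metric⁻¹ i.1 i.2 • T.pairing p (i.1, 0))
    (G := fun i => T.pairing q (i.2, 0)) fun x => by
      -- For differentiated symbols both sides vanish; the recursion is needed only at order zero.
      by_cases hx : x.ord = 0
      · have hb : x = Jet.base (x.idx, x.lvl) := by
          change x = Jet.mk _ _ 0
          rw [← hx]
        rw [hb, Finset.sum_product]
        simp only [T.pairing_comm q (_, 0)]
        simp only [Correlators.pairing, pderiv_rename_base, pderiv_bigBracket_succ, map_sum,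
          map_smul, map_mul, smul_mul_assoc]
      · simp [Correlators.pairing, pderiv_rename_base_of_ord_ne_zero hx]
  simpa only [Finset.sum_product, smul_mul_assoc] using h

/-- The Maurer–Cartan equation for the finite parts of the densities. -/
theorem maurerCartan_finite (P : Finset (Fin N × ℕ)) :
    (∑ p ∈ P, ∑ q ∈ P, quad (Jet.base p).raise (Jet.base q) (T.pairing (p.1, p.2 + 1) q)) +
      (1 / 2 : ℂ) • (-∑ β, ∑ α, T.metric⁻¹ α β •
        (totalDeriv (∑ p ∈ P, mulGen (Jet.base p) (const (T.pairing p (α, 0)))) *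
          ∑ q ∈ P, mulGen (Jet.base q) (const (T.pairing q (β, 0))))) =
    totalDeriv ((1 / 2 : ℂ) • ∑ p ∈ P, ∑ q ∈ P, quad (Jet.base p) (Jet.base q)
      (T.pairing (p.1, p.2 + 1) q)) := by
  set A : Fin N × ℕ → Fin N × ℕ → EvenSeries N := fun p q => T.pairing (p.1, p.2 + 1) q with hA
  -- The derivative falling on `ρ_p` meets the integrated recursion, and the derivative falling on
  -- the two-point function meets its differential form.
  have h1 : ∑ β, ∑ α, T.metric⁻¹ α β •
      (totalDeriv (∑ p ∈ P, mulGen (Jet.base p) (const (T.pairing p (α, 0)))) *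
        ∑ q ∈ P, mulGen (Jet.base q) (const (T.pairing q (β, 0)))) =
      ∑ p ∈ P, ∑ q ∈ P, quad (Jet.base p).raise (Jet.base q) (A p q + A q p) -
      ∑ p ∈ P, ∑ q ∈ P, quad (Jet.base p) (Jet.base q) (evenTotalDeriv (A p q)) := by
    have e1 : ∀ p q, quad (Jet.base p).raise (Jet.base q) (A p q + A q p) =
        ∑ β, ∑ α, T.metric⁻¹ α β • quad (Jet.base p).raise (Jet.base q)
          (T.pairing p (α, 0) * T.pairing q (β, 0)) := fun p q => by
      rw [hA, pairing_succ_add_pairing_succ, Finset.sum_comm]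
      simp only [map_sum, map_smul]
    -- Differential recursion puts the derivative on the factor attached to `q`, whereas the bracket
    -- has it on the one attached to `p`. Exchanging the labels costs the sign of `ρ_p ρ_q`.
    have e2 : ∑ p ∈ P, ∑ q ∈ P, quad (Jet.base p) (Jet.base q) (evenTotalDeriv (A p q)) =
        -∑ p ∈ P, ∑ q ∈ P, ∑ β, ∑ α, T.metric⁻¹ α β • quad (Jet.base p) (Jet.base q)
          (evenTotalDeriv (T.pairing p (α, 0)) * T.pairing q (β, 0)) := by
      rw [Finset.sum_comm]
      simp only [← Finset.sum_neg_distrib]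
      refine Finset.sum_congr rfl fun q _ => Finset.sum_congr rfl fun p _ => ?_
      rw [quad_swap, hA, evenTotalDeriv_pairing_succ]
      simp only [map_sum, map_smul, ← Finset.sum_neg_distrib]
      refine Finset.sum_congr rfl fun σ _ => Finset.sum_congr rfl fun τ _ => ?_
      rw [metric_inv_symm, mul_comm]
    rw [e2, sub_neg_eq_add, ← Finset.sum_add_distrib]
    simp only [e1, ← Finset.sum_add_distrib, ← smul_add]
    simp only [map_sum, totalDeriv_mulGen, totalDeriv_const, Grass.sum_mul, Grass.mul_sum,
      Grass.add_mul, mulGen_const_mul_mulGen_const, Finset.smul_sum]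
    calc _ = ∑ β, ∑ p ∈ P, ∑ q ∈ P, ∑ α, _ := Finset.sum_congr rfl fun β _ => by
          rw [Finset.sum_comm]
          refine Finset.sum_congr rfl fun p _ => ?_
          rw [Finset.sum_comm]
      _ = ∑ p ∈ P, ∑ q ∈ P, ∑ β, ∑ α, _ := by
          rw [Finset.sum_comm]
          refine Finset.sum_congr rfl fun p _ => ?_
          rw [Finset.sum_comm]
      _ = _ := Finset.sum_comm
  have h2 : totalDeriv (∑ p ∈ P, ∑ q ∈ P, quad (Jet.base p) (Jet.base q) (A p q)) =
      ∑ p ∈ P, ∑ q ∈ P, quad (Jet.base p).raise (Jet.base q) (A p q) -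
      ∑ p ∈ P, ∑ q ∈ P, quad (Jet.base p).raise (Jet.base q) (A q p) +
      ∑ p ∈ P, ∑ q ∈ P, quad (Jet.base p) (Jet.base q) (evenTotalDeriv (A p q)) := by
    -- Anticommuting `ρ_p` past `∂ρ_q` and relabelling turns the second Leibniz term into a sum of
    -- `∂ρ_p ρ_q` with `A` transposed.
    have e : ∑ p ∈ P, ∑ q ∈ P, quad (Jet.base p).raise (Jet.base q) (A q p) =
        -∑ p ∈ P, ∑ q ∈ P, quad (Jet.base p) (Jet.base q).raise (A p q) := by
      rw [Finset.sum_comm]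
      simp only [← Finset.sum_neg_distrib]
      exact Finset.sum_congr rfl fun q _ => Finset.sum_congr rfl fun p _ => quad_swap _ _ _
    rw [e, sub_neg_eq_add]
    simp only [map_sum, totalDeriv_quad, Finset.sum_add_distrib]
  -- The coefficients of `∂ρ_p ρ_q` agree because `A(p,q) - ½ (A(p,q) + A(q,p)) = ½ (A(p,q) -
  -- A(q,p))`.
  rw [h1, map_smul, h2]
  simp only [map_add, Finset.sum_add_distrib]
  module

/-- Componentwise this is `maurerCartan_finite`, for a finite `P` large enough that truncating each
infinite sum to `P` does not change the component along `u`. -/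
theorem delta_add_half_hamDeriv :
    delta T.density + (1 / 2 : ℂ) • hamDeriv T.metric⁻¹ T.density T.density =
      totalDeriv T.primitive := by
  ext1 u
  -- A total derivative in degree `u` reads components in which one symbol of `u` has been lowered,
  -- hence the lowered symbols are adjoined.
  set U : Finset (Jet N) := u ∪ u.image Jet.lower with hU
  set P : Finset (Fin N × ℕ) := U.image fun v => (v.idx, v.lvl) with hP
  have hUP : ∀ p, Jet.base p ∈ U → p ∈ P := fun p hp => Finset.mem_image.2 ⟨_, hp, rfl⟩
  have huU : u ⊆ U := Finset.subset_union_left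
  have hlU : ∀ v ∈ u, v.lower ∈ U := fun v hv =>
    Finset.mem_union_right _ (Finset.mem_image_of_mem _ hv)
  have hord : ∀ (α : Fin N) (m : ℕ), pd ⟨α, 0, m + 1⟩ T.density = 0 := fun α m =>
    T.pd_density_of_ord_ne_zero (Nat.succ_ne_zero m)
  have hpd : ∀ (α : Fin N), ∀ s ⊆ U, pd ⟨α, 0, 0⟩ T.density s =
      (∑ p ∈ P, mulGen (Jet.base p) (const (T.pairing p (α, 0)))) s := fun α s hs => by
    rw [T.pd_density]
    exact oddSum_apply _ fun q hq => hUP q (hs hq)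
  rw [totalDeriv_congr huU hlU fun s hs => T.primitive_apply fun p hp => hUP p (hs hp),
    ← T.maurerCartan_finite P, Grass.add_apply, Grass.add_apply, T.delta_density_apply hUP,
    hamDeriv_eq _ hord hord, Grass.smul_apply, Grass.smul_apply, Grass.neg_apply, Grass.neg_apply]
  refine congrArg (fun x : EvenSeries N => _ + (1 / 2 : ℂ) • -x) ?_
  rw [Grass.sum_apply, Grass.sum_apply]
  refine Finset.sum_congr rfl fun β _ => ?_
  rw [Grass.sum_apply, Grass.sum_apply]
  refine Finset.sum_congr rfl fun α _ => ?_
  rw [Grass.smul_apply, Grass.smul_apply]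
  refine congrArg (T.metric⁻¹ α β • ·) ?_
  refine Grass.mul_congr (fun s hs => ?_) fun s hs => hpd β s (hs.trans huU)
  exact totalDeriv_congr (hs.trans huU) (fun v hv => hlU v (hs hv)) (hpd α)

end GenusZeroTFT

/-! ### Products in Grassmann algebras -/

namespace Grass

variable {Y R : Type*} [LinearOrder Y] [CommRing R]

theorem sgn_union_left {s t : Finset Y} (h : Disjoint s t) (r : Finset Y) :
    sgn (s ∪ t) r = sgn s r * sgn t r :=
  Finset.prod_union h

theorem sgn_union_right {t r : Finset Y} (h : Disjoint t r) (s : Finset Y) :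
    sgn s (t ∪ r) = sgn s t * sgn s r := by
  unfold sgn
  rw [← Finset.prod_mul_distrib]
  exact Finset.prod_congr rfl fun a _ => Finset.prod_union h

/-- By disjointness, each of the `|s| |t|` pairs is inverted in exactly one of the two orders. -/
theorem sgn_comm {s t : Finset Y} (h : Disjoint s t) :
    sgn s t = (-1) ^ (s.card * t.card) * sgn t s := by
  have : ∀ a ∈ s, ∏ b ∈ t, (if b < a then (-1 : ℤ) else 1) =
      (-1) ^ t.card * ∏ b ∈ t, (if a < b then (-1 : ℤ) else 1) := by
    intro a ha
    rw [← Finset.prod_const, ← Finset.prod_mul_distrib]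
    refine Finset.prod_congr rfl fun b hb => ?_
    have hne : a ≠ b := fun e => Finset.disjoint_left.1 h ha (e ▸ hb)
    rcases lt_or_gt_of_ne hne with h1 | h1
    · simp [h1, not_lt.2 h1.le]
    · simp [h1, not_lt.2 h1.le]
  unfold sgn
  rw [Finset.prod_congr rfl this, Finset.prod_mul_distrib, Finset.prod_const, ← pow_mul,
    mul_comm t.card, Finset.prod_comm]

/-- Both sides sum over ordered partitions of `u` into the blocks `t`, `s \ t`, `u \ s`. The signs
agree because `sgn` is multiplicative over disjoint unions in each argument. -/
theorem mul_assoc (f g h : Grass Y R) : f * g * h = f * (g * h) := by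
  ext u
  simp only [mul_apply, Finset.sum_mul, Finset.mul_sum, Finset.sum_sigma']
  refine Finset.sum_bij' (fun x _ => ⟨x.2, x.1 \ x.2⟩) (fun x _ => ⟨x.1 ∪ x.2, x.1⟩) ?_ ?_ ?_ ?_ ?_
  · rintro ⟨s, t⟩ hx
    simp only [Finset.mem_sigma, Finset.mem_powerset] at hx ⊢
    exact ⟨hx.2.trans hx.1, Finset.sdiff_subset_sdiff hx.1 subset_rfl⟩
  · rintro ⟨t, r⟩ hx
    simp only [Finset.mem_sigma, Finset.mem_powerset] at hx ⊢
    exact ⟨Finset.union_subset hx.1 (hx.2.trans Finset.sdiff_subset), Finset.subset_union_left⟩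
  · rintro ⟨s, t⟩ hx
    simp only [Finset.mem_sigma, Finset.mem_powerset] at hx
    simp [Finset.union_sdiff_of_subset hx.2]
  · rintro ⟨t, r⟩ hx
    simp only [Finset.mem_sigma, Finset.mem_powerset] at hx
    have : Disjoint r t := Finset.disjoint_of_subset_left hx.2 Finset.sdiff_disjoint
    simp [Finset.union_sdiff_left, Finset.sdiff_eq_self_of_disjoint this]
  · rintro ⟨s, t⟩ hx
    simp only [Finset.mem_sigma, Finset.mem_powerset] at hx
    obtain ⟨hs, ht⟩ := hx
    have e1 : (u \ t) \ (s \ t) = u \ s := by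
      ext x; simp only [Finset.mem_sdiff]; grind
    have e2 : s = t ∪ s \ t := (Finset.union_sdiff_of_subset ht).symm
    have e3 : u \ t = s \ t ∪ u \ s := by
      ext x; simp only [Finset.mem_sdiff, Finset.mem_union]; grind
    have h1 : sgn s (u \ s) = sgn t (u \ s) * sgn (s \ t) (u \ s) := by
      conv_lhs => rw [e2]
      rw [sgn_union_left Finset.disjoint_sdiff, ← e2]
    have h2 : sgn t (u \ t) = sgn t (s \ t) * sgn t (u \ s) := by
      rw [e3, sgn_union_right]
      exact Finset.disjoint_of_subset_left Finset.sdiff_subset Finset.disjoint_sdiff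
    simp only [e1]
    rw [h1, h2]
    push_cast
    ring

theorem mul_one (f : Grass Y R) : f * 1 = f := by
  ext u
  rw [mul_apply, Finset.sum_eq_single u]
  · have : (1 : Grass Y R) (u \ u) = 1 := if_pos (Finset.sdiff_self u)
    rw [this]
    simp [sgn]
  · intro s hs hsu
    have h : u \ s ≠ ∅ := fun e =>
      hsu ((Finset.mem_powerset.1 hs).antisymm (Finset.sdiff_eq_empty_iff_subset.1 e))
    have : (1 : Grass Y R) (u \ s) = 0 := if_neg h
    simp [this]
  · simp

/-- Reversing a product, with the Koszul sign in every degree. -/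
theorem mul_apply_swap (f g : Grass Y R) (u : Finset Y) : (g * f) u =
    ∑ s ∈ u.powerset, (-1) ^ (s.card * (u \ s).card) *
      ((sgn s (u \ s) : R) * (f s * g (u \ s))) := by
  rw [mul_apply]
  refine Finset.sum_bij' (fun s _ => u \ s) (fun s _ => u \ s) ?_ ?_ ?_ ?_ ?_
  · simp
  · simp
  · intro s hs
    exact Finset.sdiff_sdiff_eq_self (Finset.mem_powerset.1 hs)
  · intro s hs
    exact Finset.sdiff_sdiff_eq_self (Finset.mem_powerset.1 hs)
  · intro s hs
    rw [Finset.sdiff_sdiff_eq_self (Finset.mem_powerset.1 hs),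
      sgn_comm (Finset.disjoint_sdiff (s := s) (t := u)), mul_comm (u \ s).card]
    push_cast
    ring

theorem mul_comm_of_even {f : Grass Y R} (hf : ∀ s, Odd s.card → f s = 0) (g : Grass Y R) :
    f * g = g * f := by
  ext u
  rw [mul_apply_swap f g, mul_apply f g]
  refine Finset.sum_congr rfl fun s _ => ?_
  rcases Nat.even_or_odd s.card with h | h
  · rw [(h.mul_right _).neg_one_pow, _root_.one_mul]
  · rw [hf s h]
    ring

theorem mul_comm_of_odd {f g : Grass Y R} (hf : ∀ s, Even s.card → f s = 0)
    (hg : ∀ s, Even s.card → g s = 0) : f * g = -(g * f) := by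
  ext u
  rw [neg_apply, mul_apply_swap f g, mul_apply f g, ← Finset.sum_neg_distrib]
  refine Finset.sum_congr rfl fun s _ => ?_
  rcases Nat.even_or_odd s.card with h | h
  · rw [hf s h]
    ring
  · rcases Nat.even_or_odd (u \ s).card with h' | h'
    · rw [hg _ h']
      ring
    · rw [(h.mul h').neg_one_pow]
      ring

theorem prod_map_perm {ι : Type*} {f : ι → Grass Y R} (hf : ∀ i j, f i * f j = f j * f i)
    {l l' : List ι} (h : l.Perm l') : (l.map f).prod = (l'.map f).prod := by
  induction h with
  | nil => rfl
  | cons a _ ih => simp only [List.map_cons, List.prod_cons, ih]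
  | swap a b l => simp only [List.map_cons, List.prod_cons, ← mul_assoc, hf a b]
  | trans _ _ h1 h2 => exact h1.trans h2

theorem prod_map_eq_zero {ι : Type*} {f : ι → Grass Y R} {l : List ι} {i : ι} (hi : i ∈ l)
    (h : f i = 0) : (l.map f).prod = 0 := by
  induction l with
  | nil => simp at hi
  | cons a l ih =>
    rw [List.map_cons, List.prod_cons]
    rcases List.mem_cons.1 hi with e | e
    · rw [← e, h, zero_mul]
    · rw [ih e, mul_zero]

/-- A product of more than `|s|` nilpotent elements has no component along `θ_s`. -/
theorem prod_map_apply_eq_zero {ι : Type*} {f : ι → Grass Y R} (hf : ∀ i, f i ∅ = 0)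
    (l : List ι) {s : Finset Y} (hs : s.card < l.length) : (l.map f).prod s = 0 := by
  induction l generalizing s with
  | nil => simp at hs
  | cons a l ih =>
    rw [List.map_cons, List.prod_cons, mul_apply]
    refine Finset.sum_eq_zero fun t ht => ?_
    rcases t.eq_empty_or_nonempty with h | h
    · simp [h, hf]
    · have h1 := Finset.card_sdiff_add_card_eq_card (Finset.mem_powerset.1 ht)
      have h2 := h.card_pos
      rw [List.length_cons] at hs
      rw [ih (by omega)]
      simp

theorem mulGen_apply_insert {v : Y} {u : Finset Y} (h : v ∉ u) (f : Grass Y R) :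
    mulGen v f (insert v u) = sgn {v} u * f u := by
  simp [mulGen, h]

end Grass

/-! ### Calculus of forms on the cylinder -/

theorem wirtinger_add {f g : ℂ → ℂ} (hf : Differentiable ℝ f) (hg : Differentiable ℝ g) :
    wirtinger (f + g) = wirtinger f + wirtinger g := by
  ext z
  simp only [wirtinger, Pi.add_apply, fderiv_add (hf z) (hg z), _root_.add_apply]
  ring

theorem wirtinger_smul {f : ℂ → ℂ} (hf : Differentiable ℝ f) (c : ℂ) :
    wirtinger (c • f) = c • wirtinger f := by
  ext z
  simp only [wirtinger, Pi.smul_apply, fderiv_const_smul (hf z) c,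
    _root_.smul_apply, smul_eq_mul]
  ring

theorem wirtinger_mul {f g : ℂ → ℂ} (hf : Differentiable ℝ f) (hg : Differentiable ℝ g) :
    wirtinger (f * g) = wirtinger f * g + f * wirtinger g := by
  ext z
  simp only [wirtinger, Pi.add_apply, Pi.mul_apply, fderiv_mul (hf z) (hg z),
    _root_.add_apply, _root_.smul_apply, smul_eq_mul]
  ring

theorem wirtinger_zero : wirtinger 0 = 0 := by
  ext z
  simp [wirtinger]

theorem wirtinger_one : wirtinger 1 = 0 := by
  ext z
  simp [wirtinger]

theorem wirtinger_sum {ι : Type*} (t : Finset ι) {f : ι → ℂ → ℂ}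
    (hf : ∀ i ∈ t, Differentiable ℝ (f i)) :
    wirtinger (∑ i ∈ t, f i) = ∑ i ∈ t, wirtinger (f i) := by
  classical
  induction t using Finset.induction_on with
  | empty => exact wirtinger_zero
  | insert a t ha ih =>
    rw [Finset.sum_insert ha, Finset.sum_insert ha,
      wirtinger_add (hf a (Finset.mem_insert_self a t)) (Differentiable.sum fun i hi =>
        hf i (Finset.mem_insert_of_mem hi)), ih fun i hi => hf i (Finset.mem_insert_of_mem hi)]

theorem contDiff_wirtinger {f : ℂ → ℂ} (hf : ContDiff ℝ (⊤ : ℕ∞) f) :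
    ContDiff ℝ (⊤ : ℕ∞) (wirtinger f) := by
  have h : ∀ v : ℂ, ContDiff ℝ (⊤ : ℕ∞) fun z => fderiv ℝ f z v := fun v =>
    (hf.fderiv_right (m := (⊤ : ℕ∞)) (by simp)).clm_apply contDiff_const
  exact ((h 1).sub (contDiff_const.mul (h Complex.I))).div_const 2

/-- By Cauchy–Riemann `∂_y f = i ∂_x f`, so the two halves of `∂_z` coincide. -/
theorem wirtinger_eq_deriv {f : ℂ → ℂ} (hf : Differentiable ℂ f) : wirtinger f = deriv f := by
  ext z
  have h := (differentiableAt_complex_iff_differentiableAt_real.1 (hf z)).2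
  have h1 : fderiv ℝ f z 1 = deriv f z := by
    rw [(hf z).fderiv_restrictScalars ℝ]
    simp
  rw [wirtinger, h, h1, smul_eq_mul, ← _root_.mul_assoc, Complex.I_mul_I]
  ring

theorem differentiable_of_wirtingerBar {f : ℂ → ℂ} (hf : Differentiable ℝ f)
    (h : wirtingerBar f = 0) : Differentiable ℂ f := fun z => by
  refine differentiableAt_complex_iff_differentiableAt_real.2 ⟨hf z, ?_⟩
  have h1 : (fderiv ℝ f z 1 + Complex.I * fderiv ℝ f z Complex.I) / 2 = 0 := congrFun h z
  rw [smul_eq_mul]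
  linear_combination (-2 * Complex.I) * h1 + (fderiv ℝ f z Complex.I) * Complex.I_mul_I

namespace SuperForm

open Grass

variable {q : ℕ}

/-- All components are smooth. -/
def Smooth (f : SuperForm q) : Prop := ∀ s, ContDiff ℝ (⊤ : ℕ∞) (f s)

/-- All components without `dz̄` are holomorphic and periodic. -/
def Holomorphic (f : SuperForm q) : Prop :=
  ∀ s, 0 ∉ s → Differentiable ℂ (f s) ∧ ∀ z, f s (z + 1) = f s z

theorem Smooth.differentiable {f : SuperForm q} (hf : f.Smooth) (s : Finset (Fin (q + 1))) :
    Differentiable ℝ (f s) := (hf s).differentiable (by simp)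

theorem Smooth.add {f g : SuperForm q} (hf : f.Smooth) (hg : g.Smooth) : (f + g).Smooth :=
  fun s => (hf s).add (hg s)

theorem Smooth.smul {f : SuperForm q} (hf : f.Smooth) (c : ℂ) : (c • f).Smooth :=
  fun s => (hf s).const_smul c

theorem Smooth.zero : (0 : SuperForm q).Smooth := fun _ => contDiff_const

theorem Smooth.one : (1 : SuperForm q).Smooth := fun s => by
  change ContDiff ℝ _ (if s = ∅ then 1 else 0 : ℂ → ℂ)
  split_ifs
  exacts [contDiff_const, contDiff_const]

theorem mul_apply_eq (f g : SuperForm q) (u : Finset (Fin (q + 1))) :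
    (f * g) u = ∑ s ∈ u.powerset, (sgn s (u \ s) : ℂ) • (f s * g (u \ s)) := by
  rw [mul_apply]
  refine Finset.sum_congr rfl fun s _ => ?_
  ext z
  simp

theorem Smooth.mul {f g : SuperForm q} (hf : f.Smooth) (hg : g.Smooth) : (f * g).Smooth :=
  fun u => by
    rw [mul_apply_eq]
    rw [Finset.sum_fn]
    exact ContDiff.sum fun s _ =>
      contDiff_const.smul (f := fun _ => (sgn s (u \ s) : ℂ)) ((hf s).mul (hg (u \ s)))

theorem Smooth.dz {f : SuperForm q} (hf : f.Smooth) : f.dz.Smooth :=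
  fun s => contDiff_wirtinger (hf s)

theorem dz_add {f g : SuperForm q} (hf : f.Smooth) (hg : g.Smooth) :
    (f + g).dz = f.dz + g.dz :=
  Grass.ext fun s => wirtinger_add (hf.differentiable s) (hg.differentiable s)

theorem dz_smul {f : SuperForm q} (hf : f.Smooth) (c : ℂ) : (c • f).dz = c • f.dz :=
  Grass.ext fun s => wirtinger_smul (hf.differentiable s) c

theorem dz_zero : (0 : SuperForm q).dz = 0 := Grass.ext fun _ => wirtinger_zero

theorem dz_one : (1 : SuperForm q).dz = 0 := Grass.ext fun s => by
  change wirtinger (if s = ∅ then 1 else 0 : ℂ → ℂ) = 0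
  split_ifs
  exacts [wirtinger_one, wirtinger_zero]

theorem dz_mul {f g : SuperForm q} (hf : f.Smooth) (hg : g.Smooth) :
    (f * g).dz = f.dz * g + f * g.dz := by
  ext1 u
  have h : ∀ s, Differentiable ℝ (f s * g (u \ s)) := fun s =>
    (hf.differentiable s).mul (hg.differentiable _)
  change wirtinger ((f * g) u) = _
  rw [Grass.add_apply, mul_apply_eq, mul_apply_eq, mul_apply_eq,
    wirtinger_sum _ fun s _ => (h s).const_smul _, ← Finset.sum_add_distrib]
  refine Finset.sum_congr rfl fun s _ => ?_
  rw [wirtinger_smul (h s), wirtinger_mul (hf.differentiable s) (hg.differentiable _), smul_add]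
  rfl

theorem Holomorphic.add {f g : SuperForm q} (hf : f.Holomorphic) (hg : g.Holomorphic) :
    (f + g).Holomorphic := fun s hs =>
  ⟨(hf s hs).1.add (hg s hs).1, fun z => by
    simp only [Grass.add_apply, Pi.add_apply, (hf s hs).2, (hg s hs).2]⟩

theorem Holomorphic.smul {f : SuperForm q} (hf : f.Holomorphic) (c : ℂ) :
    (c • f).Holomorphic := fun s hs =>
  ⟨(hf s hs).1.const_smul c, fun z => by
    simp only [Grass.smul_apply, Pi.smul_apply, (hf s hs).2]⟩

theorem Holomorphic.zero : (0 : SuperForm q).Holomorphic := fun _ _ =>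
  ⟨differentiable_const 0, fun _ => rfl⟩

theorem Holomorphic.one : (1 : SuperForm q).Holomorphic := fun s _ => by
  have : (1 : SuperForm q) s = if s = ∅ then 1 else 0 := rfl
  rw [this]
  split_ifs
  exacts [⟨differentiable_const 1, fun _ => rfl⟩, ⟨differentiable_const 0, fun _ => rfl⟩]

/-- A degree not containing `dz̄` splits only into degrees not containing it, so the unconstrained
`dz̄` components never enter. -/
theorem Holomorphic.mul {f g : SuperForm q} (hf : f.Holomorphic) (hg : g.Holomorphic) :
    (f * g).Holomorphic := fun u hu => by
  have h1 : ∀ s ∈ u.powerset, 0 ∉ s := fun s hs h => hu (Finset.mem_powerset.1 hs h)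
  have h2 : ∀ s, 0 ∉ u \ s := fun s h => hu (Finset.mem_sdiff.1 h).1
  rw [mul_apply_eq]
  refine ⟨Differentiable.sum fun s hs =>
    ((hf s (h1 s hs)).1.mul (hg _ (h2 s)).1).const_smul _, fun z => ?_⟩
  rw [Finset.sum_apply, Finset.sum_apply]
  refine Finset.sum_congr rfl fun s hs => ?_
  simp only [Pi.smul_apply, Pi.mul_apply, (hf s (h1 s hs)).2, (hg _ (h2 s)).2]

theorem Holomorphic.dz {f : SuperForm q} (hf : f.Holomorphic) : f.dz.Holomorphic := fun s hs => by
  change Differentiable ℂ (wirtinger (f s)) ∧ ∀ z, wirtinger (f s) (z + 1) = wirtinger (f s) z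
  rw [wirtinger_eq_deriv (hf s hs).1]
  refine ⟨(hf s hs).1.deriv, fun z => ?_⟩
  rw [← deriv_comp_add_const]
  exact congrArg (fun h => deriv h z) (funext (hf s hs).2)

/-- Along `dz̄ θ_s` the form `∂̄f` is `∂_z̄ f_s` up to an invertible sign. Components that already
contain `dz̄` are killed by `∂̄`, which is why nothing is claimed about them. -/
theorem holomorphic_of_dbar_eq_zero {f : SuperForm q} (hf : f.Smooth) (h : f.dbar = 0)
    (hper : ∀ s z, f s (z + 1) = f s z) : f.Holomorphic := fun s hs => by
  refine ⟨differentiable_of_wirtingerBar (hf.differentiable s) ?_, hper s⟩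
  have h1 : f.dbar (insert 0 s) = 0 := by rw [h]; rfl
  replace h1 : ((sgn {0} s : ℤ) : ℂ → ℂ) * wirtingerBar (f s) = 0 :=
    (mulGen_apply_insert hs (fun s => wirtingerBar (f s) : SuperForm q)).symm.trans h1
  have h2 : (((sgn {0} s : ℤ) : ℂ → ℂ)) * ((sgn {0} s : ℤ) : ℂ → ℂ) = 1 := by
    rw [← Int.cast_mul, sgn_sq, Int.cast_one]
  rw [← _root_.one_mul (wirtingerBar (f s)), ← h2, _root_.mul_assoc, h1, MulZeroClass.mul_zero]

end SuperForm

/-! ### Densities with finitely many monomials -/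

namespace Density

open MvPowerSeries Grass

variable {N : ℕ}

/-- The density `λ^n ρ_u`. -/
noncomputable def mono (u : Finset (Jet N)) (n : Jet N →₀ ℕ) : Density N :=
  fun s => if s = u then MvPowerSeries.monomial n 1 else 0

open Classical in
theorem coeff_mono (u s : Finset (Jet N)) (n m : Jet N →₀ ℕ) :
    coeff m (mono u n s) = if (s, m) = (u, n) then 1 else 0 := by
  unfold mono
  by_cases h : s = u
  · simp [h, coeff_monomial]
  · simp [h]

/-- The densities with finitely many monomials. -/
noncomputable def poly (N : ℕ) : Submodule ℂ (Density N) :=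
  Submodule.span ℂ (Set.range fun p : Finset (Jet N) × (Jet N →₀ ℕ) => mono p.1 p.2)

theorem mono_mem_poly (u : Finset (Jet N)) (n : Jet N →₀ ℕ) : mono u n ∈ poly N :=
  Submodule.subset_span ⟨(u, n), rfl⟩

/-- The pairs `(u, n)` such that `λ^n ρ_u` occurs in `f`. -/
def monomials (f : Density N) : Set (Finset (Jet N) × (Jet N →₀ ℕ)) :=
  {p | coeff p.2 (f p.1) ≠ 0}

theorem finite_monomials {f : Density N} (hf : f ∈ poly N) : (monomials f).Finite := by
  classical
  induction hf using Submodule.span_induction with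
  | mem x h =>
    obtain ⟨p, rfl⟩ := h
    refine (Set.finite_singleton p).subset fun q hq => ?_
    by_contra hqp
    exact hq ((coeff_mono _ _ _ _).trans (if_neg hqp))
  | zero => simp [monomials]
  | add x y _ _ hx hy =>
    refine (hx.union hy).subset fun q hq => ?_
    by_contra h
    simp only [monomials, Set.mem_union, Set.mem_ofPred_eq, not_or, not_not] at h
    exact hq (by rw [Grass.add_apply, map_add, h.1, h.2, _root_.add_zero])
  | smul c x _ hx =>
    refine hx.subset fun q hq h => hq ?_
    rw [Grass.smul_apply, map_smul, h, smul_zero]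

theorem mem_poly_of_finite {f : Density N} (hf : (monomials f).Finite) : f ∈ poly N := by
  classical
  have h : f = ∑ p ∈ hf.toFinset, coeff p.2 (f p.1) • mono p.1 p.2 := by
    ext u n
    rw [Grass.sum_apply, map_sum]
    simp only [Grass.smul_apply, map_smul, coeff_mono, smul_eq_mul, mul_ite, MulZeroClass.mul_zero,
      _root_.mul_one]
    simp only [Prod.mk.eta]
    rw [Finset.sum_ite_eq]
    split_ifs with h
    · rfl
    · simpa [monomials] using h
  rw [h]
  exact Submodule.sum_mem _ fun p _ => Submodule.smul_mem _ _ (mono_mem_poly _ _)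

/-! ### Multiplication by generators and the total derivative on monomials. -/

theorem mulGen_mono {v : Jet N} {u : Finset (Jet N)} (h : v ∉ u) (n : Jet N →₀ ℕ) :
    mulGen v (mono u n) = (sgn {v} u : ℂ) • mono (insert v u) n := by
  ext1 s
  rw [Grass.smul_apply]
  by_cases hs : s = insert v u
  · subst hs
    rw [mulGen_apply_insert h, mono, mono, if_pos rfl, if_pos rfl, Int.cast_smul_eq_zsmul,
      zsmul_eq_mul]
  · have h1 : mono (insert v u) n s = 0 := if_neg hs
    rw [h1, smul_zero]
    simp only [mulGen, mono]
    split_ifs with hv he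
    · exact absurd (by rw [← he, Finset.insert_erase hv]) hs
    · rw [MulZeroClass.mul_zero]
    · rfl

theorem mulGen_mono_of_mem {v : Jet N} {u : Finset (Jet N)} (h : v ∈ u) (n : Jet N →₀ ℕ) :
    mulGen v (mono u n) = 0 := by
  ext1 s
  simp only [mulGen, mono, Grass.zero_apply]
  split_ifs with hv he
  · exact absurd (he ▸ h) (Finset.notMem_erase v s)
  · rw [MulZeroClass.mul_zero]
  · rfl

theorem const_X_mul_mono (v : Jet N) (u : Finset (Jet N)) (n : Jet N →₀ ℕ) :
    const (X v) * mono u n = mono u (n + Finsupp.single v 1) := by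
  ext1 s
  rw [const_mul_apply]
  unfold mono
  split_ifs
  · rw [X, monomial_mul_monomial, _root_.one_mul, add_comm]
  · rw [MulZeroClass.mul_zero]

theorem mulGen_mem_poly (v : Jet N) {f : Density N} (hf : f ∈ poly N) : mulGen v f ∈ poly N := by
  induction hf using Submodule.span_induction with
  | mem x h =>
    obtain ⟨p, rfl⟩ := h
    by_cases hv : v ∈ p.1
    · simp only [mulGen_mono_of_mem hv]
      exact Submodule.zero_mem _
    · simp only [mulGen_mono hv]
      exact Submodule.smul_mem _ _ (mono_mem_poly _ _)
  | zero => rw [mulGen_zero]; exact Submodule.zero_mem _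
  | add x y _ _ hx hy => rw [mulGen_add]; exact Submodule.add_mem _ hx hy
  | smul c x _ hx => rw [mulGen_smul]; exact Submodule.smul_mem _ _ hx

theorem const_X_mul_mem_poly (v : Jet N) {f : Density N} (hf : f ∈ poly N) :
    const (X v) * f ∈ poly N := by
  induction hf using Submodule.span_induction with
  | mem x h =>
    obtain ⟨p, rfl⟩ := h
    simp only [const_X_mul_mono]
    exact mono_mem_poly _ _
  | zero => rw [Grass.mul_zero]; exact Submodule.zero_mem _
  | add x y _ _ hx hy => rw [Grass.mul_add]; exact Submodule.add_mem _ hx hy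
  | smul c x _ hx => rw [Grass.mul_smul']; exact Submodule.smul_mem _ _ hx

theorem evenTotalDeriv_X (v : Jet N) : evenTotalDeriv (X v : EvenSeries N) = X v.raise := by
  ext n
  rw [coeff_evenTotalDeriv (Finset.subset_insert v.raise n.support),
    Finset.sum_eq_single v.raise]
  · rw [Jet.lower_raise, pderiv_X_self, _root_.mul_one]
  · intro w hw hne
    have : v ≠ w.lower := fun e => hne (by rw [e, Jet.raise_lower (Finset.mem_filter.1 hw).2])
    rw [pderiv_X_of_ne this, MulZeroClass.mul_zero, map_zero]
  · intro h
    exact absurd (Finset.mem_filter.2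
      ⟨Finset.mem_insert_self v.raise n.support, Nat.succ_ne_zero v.ord⟩) h

theorem totalDeriv_const_X_mul (v : Jet N) (f : Density N) :
    totalDeriv (const (X v) * f) = const (X v.raise) * f + const (X v) * totalDeriv f := by
  rw [totalDeriv_mul, totalDeriv_const, evenTotalDeriv_X]

/-- An induction principle for the monomials. -/
theorem mono_induction {motive : Density N → Prop} (one : motive (mono ∅ 0))
    (even : ∀ v f, motive f → motive (const (X v) * f)) (odd : ∀ v f, motive f → motive (mulGen v f))
    (u : Finset (Jet N)) (n : Jet N →₀ ℕ) : motive (mono u n) := by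
  induction u using Finset.induction_on_min with
  | empty =>
    obtain ⟨m, rfl⟩ := Multiset.toFinsupp.surjective n
    induction m using Multiset.induction with
    | empty => simpa using one
    | cons a m ih =>
      have h := even a _ ih
      rw [const_X_mul_mono] at h
      rwa [← Multiset.singleton_add, map_add, Multiset.toFinsupp_singleton, add_comm]
  | insert a u ha ih =>
    have hau : a ∉ u := fun h => lt_irrefl _ (ha a h)
    have h := odd a _ ih
    -- Odd symbols are added on the left in decreasing order, so the new one is the smallest and no
    -- sign arises.
    have h1 : sgn {a} u = 1 := by
      rw [sgn, Finset.prod_singleton]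
      exact Finset.prod_eq_one fun b hb => if_neg (ha b hb).not_gt
    rwa [mulGen_mono hau, h1, Int.cast_one, one_smul] at h

theorem totalDeriv_one : totalDeriv (1 : Density N) = 0 := by
  change totalDeriv (const 1) = 0
  rw [totalDeriv_const, evenTotalDeriv_one]
  exact Grass.ext fun s => by simp [const_apply]

theorem totalDeriv_mem_poly {f : Density N} (hf : f ∈ poly N) : totalDeriv f ∈ poly N := by
  induction hf using Submodule.span_induction with
  | mem x h =>
    obtain ⟨p, rfl⟩ := h
    -- Membership of `f` itself is carried along, since the Leibniz rule also produces terms with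
    -- `f` undifferentiated.
    refine (mono_induction (motive := fun f => f ∈ poly N ∧ totalDeriv f ∈ poly N)
      ⟨mono_mem_poly _ _, ?_⟩ (fun v f h => ⟨const_X_mul_mem_poly v h.1, ?_⟩)
      (fun v f h => ⟨mulGen_mem_poly v h.1, ?_⟩) p.1 p.2).2
    · rw [show (mono ∅ 0 : Density N) = 1 from rfl, totalDeriv_one]
      exact Submodule.zero_mem _
    · rw [totalDeriv_const_X_mul]
      exact Submodule.add_mem _ (const_X_mul_mem_poly _ h.1) (const_X_mul_mem_poly _ h.2)
    · rw [totalDeriv_mulGen]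
      exact Submodule.add_mem _ (mulGen_mem_poly _ h.1) (mulGen_mem_poly _ h.2)
  | zero => rw [map_zero]; exact Submodule.zero_mem _
  | add x y _ _ hx hy => rw [map_add]; exact Submodule.add_mem _ hx hy
  | smul c x _ hx => rw [map_smul]; exact Submodule.smul_mem _ c hx

/-! ### Relevant monomials -/

/-- The monomials `λ^n ρ_u` in symbols `∂_z^m λ^α_k`, `∂_z^m ρ^α_k` with `k < K` that have
degree at most `d` in the even symbols. -/
def relevant (N K d : ℕ) : Set (Finset (Jet N) × (Jet N →₀ ℕ)) :=
  {p | (∀ v ∈ p.1, v.lvl < K) ∧ (∀ v ∈ p.2.support, v.lvl < K) ∧ p.2.degree ≤ d}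

/-- `∂_z` changes neither levels nor the degree in the even symbols; it only raises orders. Relevant
coefficients of `∂_z f` thus come from relevant coefficients of `f`. -/
theorem coeff_totalDeriv_eq_zero {K d : ℕ} {f : Density N}
    (hf : ∀ p ∈ relevant N K d, coeff p.2 (f p.1) = 0) :
    ∀ p ∈ relevant N K d, coeff p.2 (totalDeriv f p.1) = 0 := by
  rintro ⟨u, n⟩ ⟨hu, hn, hd⟩
  dsimp only at hu hn hd ⊢
  rw [totalDeriv_apply, map_add, coeff_evenTotalDeriv subset_rfl,
    oddTotalDeriv_apply subset_rfl, map_sum, Finset.sum_eq_zero, Finset.sum_eq_zero, add_zero]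
  · intro v hv
    have hvu := (Finset.mem_filter.1 hv).1
    simp only [mulGen, contract, if_pos hvu]
    split_ifs with h
    · simp
    · rw [← zsmul_eq_mul, ← zsmul_eq_mul, map_zsmul, map_zsmul,
        hf (insert v.lower (u.erase v), n), smul_zero, smul_zero]
      refine ⟨fun w hw => ?_, hn, hd⟩
      rcases Finset.mem_insert.1 hw with e | e
      · rw [e]; exact hu v hvu
      · exact hu w (Finset.mem_of_mem_erase e)
  · intro v hv
    have hvn := (Finset.mem_filter.1 hv).1
    obtain ⟨n, rfl⟩ : ∃ n', n = n' + Finsupp.single v 1 := by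
      refine ⟨n - Finsupp.single v 1, (tsub_add_cancel_of_le ?_).symm⟩
      rw [Finsupp.single_le_iff]
      exact Nat.one_le_iff_ne_zero.2 (Finsupp.mem_support_iff.1 hvn)
    rw [add_comm, X, coeff_add_monomial_mul, _root_.one_mul, coeff_pderiv,
      hf (u, n + Finsupp.single v.lower 1), MulZeroClass.zero_mul]
    refine ⟨hu, fun w hw => ?_, ?_⟩
    · by_cases hwn : n w = 0
      · have : w = v.lower := by
          by_contra hne
          simp [hwn, Finsupp.single_eq_of_ne hne] at hw
        rw [this]
        exact hn v hvn
      · exact hn w (by simp [hwn])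
    · simpa using hd

/-- Only finitely many relevant monomials occur in `f`. -/
def Tame (K d : ℕ) (f : Density N) : Prop := (relevant N K d ∩ monomials f).Finite

open Classical in
/-- The part of `f` consisting of the relevant monomials. -/
noncomputable def truncate (K d : ℕ) (f : Density N) : Density N :=
  fun u n => if (u, n) ∈ relevant N K d then coeff n (f u) else 0

open Classical in
theorem coeff_truncate (K d : ℕ) (f : Density N) (u : Finset (Jet N)) (n : Jet N →₀ ℕ) :
    coeff n (truncate K d f u) = if (u, n) ∈ relevant N K d then coeff n (f u) else 0 := rfl

theorem coeff_truncate_of_mem {K d : ℕ} (f : Density N) {p : Finset (Jet N) × (Jet N →₀ ℕ)}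
    (h : p ∈ relevant N K d) : coeff p.2 (truncate K d f p.1) = coeff p.2 (f p.1) := by
  classical
  rw [coeff_truncate, if_pos h]

theorem Tame.truncate_mem_poly {K d : ℕ} {f : Density N} (hf : Tame K d f) :
    truncate K d f ∈ poly N := by
  classical
  refine mem_poly_of_finite (hf.subset fun p hp => ?_)
  have hp' : coeff p.2 (truncate K d f p.1) ≠ 0 := hp
  rw [coeff_truncate] at hp'
  exact ⟨(ite_ne_right_iff.1 hp').1, (ite_ne_right_iff.1 hp').2⟩

/-- Tameness is tested against a finite model that agrees on relevant monomials, which transfers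
closure properties from `poly` to tame densities. -/
theorem tame_of_mem_poly {K d : ℕ} {f g : Density N} (hg : g ∈ poly N)
    (h : ∀ p ∈ relevant N K d, coeff p.2 (f p.1) = coeff p.2 (g p.1)) : Tame K d f :=
  (finite_monomials hg).subset fun p hp hp' => hp.2 ((h p hp.1).trans hp')

theorem Tame.smul {K d : ℕ} {f : Density N} (hf : Tame K d f) (c : ℂ) : Tame K d (c • f) :=
  tame_of_mem_poly (Submodule.smul_mem _ c hf.truncate_mem_poly) fun p hp => by
    rw [Grass.smul_apply, Grass.smul_apply, map_smul, map_smul, coeff_truncate_of_mem f hp]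

theorem Tame.add {K d : ℕ} {f g : Density N} (hf : Tame K d f) (hg : Tame K d g) :
    Tame K d (f + g) :=
  tame_of_mem_poly (Submodule.add_mem _ hf.truncate_mem_poly hg.truncate_mem_poly) fun p hp => by
    rw [Grass.add_apply, Grass.add_apply, map_add, map_add, coeff_truncate_of_mem f hp,
      coeff_truncate_of_mem g hp]

theorem coeff_totalDeriv_truncate {K d : ℕ} (f : Density N) :
    ∀ p ∈ relevant N K d, coeff p.2 (totalDeriv f p.1) =
      coeff p.2 (totalDeriv (truncate K d f) p.1) := by
  intro p hp
  have h := coeff_totalDeriv_eq_zero (f := f - truncate K d f) (fun p hp => by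
    rw [Grass.sub_apply, map_sub, coeff_truncate_of_mem f hp, sub_self]) p hp
  rwa [map_sub, Grass.sub_apply, map_sub, sub_eq_zero] at h

theorem Tame.totalDeriv {K d : ℕ} {f : Density N} (hf : Tame K d f) :
    Tame K d (Density.totalDeriv f) :=
  tame_of_mem_poly (totalDeriv_mem_poly hf.truncate_mem_poly) (coeff_totalDeriv_truncate f)

/-- All monomials of `f` contain at most `M` derivatives. -/
def WeightLE (M : ℕ) (f : Density N) : Prop :=
  ∀ u n, M < weight u n → coeff n (f u) = 0

/-- Bounded weight bounds the order of each symbol that occurs. With the level also bounded, only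
finitely many symbols remain; the odd part is a subset of these, and the exponents of the even part
are at most `d`. -/
theorem WeightLE.tame {M : ℕ} {f : Density N} (hf : WeightLE M f) (K d : ℕ) : Tame K d f := by
  classical
  let J : Finset (Jet N) := ((Finset.univ : Finset (Fin N)) ×ˢ (Finset.range K ×ˢ
    Finset.range (M + 1))).image fun t => ⟨t.1, t.2.1, t.2.2⟩
  have hJ : ∀ v : Jet N, v.lvl < K → v.ord ≤ M → v ∈ J := fun v h1 h2 =>
    Finset.mem_image.2 ⟨(v.idx, v.lvl, v.ord), by simp; omega, rfl⟩
  -- The exponent equal to `d` on every admissible symbol dominates all even parts in question.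
  let B : Jet N →₀ ℕ := ∑ v ∈ J, Finsupp.single v d
  have hB : ∀ v ∈ J, B v = d := fun v hv => by
    simp only [B, Finsupp.finsetSum_apply]
    rw [Finset.sum_eq_single v]
    · simp
    · intro w _ hw
      exact Finsupp.single_eq_of_ne hw.symm
    · exact fun h => absurd hv h
  refine (J.powerset ×ˢ Finset.Iic B).finite_toSet.subset ?_
  rintro ⟨u, n⟩ ⟨⟨hu, hn, hd⟩, hf'⟩
  have hw : weight u n ≤ M := by
    by_contra h
    exact hf' (hf u n (not_le.1 h))
  unfold weight at hw
  simp only [Finset.coe_product, Set.mem_prod, Finset.mem_coe, Finset.mem_powerset,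
    Finset.mem_Iic]
  constructor
  · intro v hv
    refine hJ v (hu v hv) ?_
    have := Finset.single_le_sum (f := fun v : Jet N => v.ord) (fun _ _ => Nat.zero_le _) hv
    omega
  · intro v
    by_cases hv : v ∈ n.support
    · have h1 := Finset.single_le_sum (f := fun v : Jet N => n v * v.ord)
        (fun _ _ => Nat.zero_le _) hv
      have h2 : v.ord ≤ n v * v.ord :=
        Nat.le_mul_of_pos_left _ (Nat.pos_of_ne_zero (Finsupp.mem_support_iff.1 hv))
      have h3 : n.sum (fun v e => e * v.ord) = ∑ v ∈ n.support, n v * v.ord := rfl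
      rw [hB v (hJ v (hn v hv) (by omega))]
      exact (Finsupp.le_degree v n).trans hd
    · rw [Finsupp.notMem_support_iff.1 hv]
      exact Nat.zero_le _

/-- One even symbol is traded for an odd one of order higher by one. -/
theorem weightLE_delta {M : ℕ} {f : Density N} (hf : WeightLE M f) :
    WeightLE (M + 1) (delta f) := by
  intro u n hw
  rw [delta_apply subset_rfl, map_sum]
  refine Finset.sum_eq_zero fun v hv => ?_
  obtain ⟨hvu, hv0⟩ := Finset.mem_filter.1 hv
  rw [mulGen, if_pos hvu, ← zsmul_eq_mul, map_zsmul, pd_apply, coeff_pderiv, hf,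
    MulZeroClass.zero_mul, smul_zero]
  have hu := weight_insert (Finset.notMem_erase v u) n
  rw [Finset.insert_erase hvu] at hu
  rw [weight_add_single]
  change M < _ + (v.ord - 1)
  omega

theorem weightLE_oddSum {M : ℕ} {a : Fin N × ℕ → Density N} (ha : ∀ p, WeightLE M (a p)) :
    WeightLE M (oddSum a) := by
  intro u n hw
  have h : ∀ p, Jet.base p ∈ u → p ∈ u.image fun v => (v.idx, v.lvl) := fun p hp =>
    Finset.mem_image.2 ⟨_, hp, rfl⟩
  rw [oddSum_apply a h, Grass.sum_apply, map_sum]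
  refine Finset.sum_eq_zero fun p _ => ?_
  unfold mulGen
  split_ifs with hpu
  · have hu := weight_insert (Finset.notMem_erase (Jet.base p) u) n
    rw [Finset.insert_erase hpu, show (Jet.base p).ord = 0 from rfl] at hu
    rw [← zsmul_eq_mul, map_zsmul, ha, smul_zero]
    omega
  · exact map_zero _

theorem weightLE_const_rename_base (F : MvPowerSeries (Fin N × ℕ) ℂ) :
    WeightLE 0 (const (rename Jet.base F)) := by
  classical
  intro u n hw
  rw [const_apply]
  split_ifs with h
  · rw [coeff_rename_base, if_neg]
    intro h0
    refine hw.ne' ?_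
    rw [h, weight, Finset.sum_empty, _root_.zero_add]
    refine Finset.sum_eq_zero fun v _ => ?_
    by_cases hv : v.ord = 0
    · simp [hv]
    · simp [h0 v hv]
  · exact map_zero _

theorem WeightLE.smul {M : ℕ} {f : Density N} (hf : WeightLE M f) (c : ℂ) :
    WeightLE M (c • f) := fun u n hw => by
  rw [Grass.smul_apply, map_smul, hf u n hw, smul_zero]

end Density

/-! ### Evaluation of densities at a field -/

namespace BCOVField

open Density SuperForm
open Grass hiding add_mul mul_add mul_zero zero_mul one_mul mul_one mul_assoc neg_mul

variable {N q : ℕ} (φ : BCOVField N q)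

theorem dz_iterate_apply_eq_zero {f : SuperForm q} {s : Finset (Fin (q + 1))} (h : f s = 0)
    (m : ℕ) : (SuperForm.dz^[m] f) s = 0 := by
  induction m with
  | zero => exact h
  | succ m ih =>
    rw [Function.iterate_succ_apply']
    exact (congrArg wirtinger ih).trans wirtinger_zero

theorem lamJet_even (v : Jet N) (s : Finset (Fin (q + 1))) (h : Odd s.card) :
    φ.lamJet v s = 0 := dz_iterate_apply_eq_zero (φ.lam_even _ _ s h) _

theorem rhoJet_odd (v : Jet N) (s : Finset (Fin (q + 1))) (h : Even s.card) :
    φ.rhoJet v s = 0 := dz_iterate_apply_eq_zero (φ.rho_odd _ _ s h) _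

theorem lamJet_empty (v : Jet N) : φ.lamJet v ∅ = 0 :=
  dz_iterate_apply_eq_zero (φ.lam_formal _ _) _

theorem lamJet_raise (v : Jet N) : φ.lamJet v.raise = (φ.lamJet v).dz :=
  Function.iterate_succ_apply' _ _ _

theorem rhoJet_raise (v : Jet N) : φ.rhoJet v.raise = (φ.rhoJet v).dz :=
  Function.iterate_succ_apply' _ _ _

theorem lamJet_eq_zero {v : Jet N} (h : φ.lam v.idx v.lvl = 0) : φ.lamJet v = 0 :=
  Grass.ext fun s => dz_iterate_apply_eq_zero (by rw [h]; rfl) _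

theorem rhoJet_eq_zero {v : Jet N} (h : φ.rho v.idx v.lvl = 0) : φ.rhoJet v = 0 :=
  Grass.ext fun s => dz_iterate_apply_eq_zero (by rw [h]; rfl) _

theorem smooth_dz_iterate {f : SuperForm q} (hf : f.Smooth) (m : ℕ) :
    (SuperForm.dz^[m] f).Smooth := by
  induction m with
  | zero => exact hf
  | succ m ih => rw [Function.iterate_succ_apply']; exact ih.dz

theorem smooth_lamJet (v : Jet N) : (φ.lamJet v).Smooth :=
  smooth_dz_iterate (φ.lam_smooth _ _) _

theorem smooth_rhoJet (v : Jet N) : (φ.rhoJet v).Smooth :=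
  smooth_dz_iterate (φ.rho_smooth _ _) _

theorem holomorphic_dz_iterate {f : SuperForm q} (hf : f.Holomorphic) (m : ℕ) :
    (SuperForm.dz^[m] f).Holomorphic := by
  induction m with
  | zero => exact hf
  | succ m ih => rw [Function.iterate_succ_apply']; exact ih.dz

variable {φ} in
theorem DbarClosed.holomorphic_lamJet (h : φ.DbarClosed) (v : Jet N) :
    (φ.lamJet v).Holomorphic :=
  holomorphic_dz_iterate (holomorphic_of_dbar_eq_zero (φ.lam_smooth _ _) (h _ _).1
    (φ.lam_periodic _ _)) _

variable {φ} in
theorem DbarClosed.holomorphic_rhoJet (h : φ.DbarClosed) (v : Jet N) :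
    (φ.rhoJet v).Holomorphic :=
  holomorphic_dz_iterate (holomorphic_of_dbar_eq_zero (φ.rho_smooth _ _) (h _ _).2
    (φ.rho_periodic _ _)) _

/-- The value of `λ^n` at the field. -/
noncomputable def lamProd (n : Jet N →₀ ℕ) : SuperForm q :=
  (((Finsupp.toMultiset n).sort).map φ.lamJet).prod

/-- The value of `ρ_u` at the field. -/
noncomputable def rhoProd (u : Finset (Jet N)) : SuperForm q :=
  ((u.sort).map φ.rhoJet).prod

theorem monomial_eq (u : Finset (Jet N)) (n : Jet N →₀ ℕ) :
    φ.monomial u n = φ.lamProd n * φ.rhoProd u := rfl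

theorem lamProd_mul_comm (n : Jet N →₀ ℕ) (g : SuperForm q) :
    φ.lamProd n * g = g * φ.lamProd n := by
  have : ∀ l : List (Jet N), (l.map φ.lamJet).prod * g = g * (l.map φ.lamJet).prod := by
    intro l
    induction l with
    | nil => exact (Grass.one_mul g).trans (Grass.mul_one g).symm
    | cons a l ih =>
      rw [List.map_cons, List.prod_cons, Grass.mul_assoc, ih, ← Grass.mul_assoc,
        mul_comm_of_even (φ.lamJet_even a), Grass.mul_assoc]
  exact this _

theorem lamJet_mul_lamProd (v : Jet N) (n : Jet N →₀ ℕ) :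
    φ.lamJet v * φ.lamProd n = φ.lamProd (n + Finsupp.single v 1) := by
  have h : (v :: (Finsupp.toMultiset n).sort).Perm
      (Finsupp.toMultiset (n + Finsupp.single v 1)).sort := by
    rw [← Multiset.coe_eq_coe, ← Multiset.cons_coe, Multiset.sort_eq, Multiset.sort_eq,
      Finsupp.toMultiset_add, Finsupp.toMultiset_single, one_smul, add_comm,
      Multiset.singleton_add]
  exact prod_map_perm (fun i j => mul_comm_of_even (φ.lamJet_even i) _) h

theorem rhoJet_mul_rhoJet (v w : Jet N) :
    φ.rhoJet v * φ.rhoJet w = -(φ.rhoJet w * φ.rhoJet v) :=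
  mul_comm_of_odd (φ.rhoJet_odd v) (φ.rhoJet_odd w)

/-- It equals its own negative, and `2` is invertible. -/
theorem rhoJet_mul_self (v : Jet N) : φ.rhoJet v * φ.rhoJet v = 0 := by
  ext1 s
  funext z
  exact self_eq_neg.1 (congrFun (congrFun (φ.rhoJet_mul_rhoJet v v) s) z)

theorem rhoProd_insert_of_lt {a : Jet N} {u : Finset (Jet N)} (h : ∀ b ∈ u, a < b) :
    φ.rhoProd (insert a u) = φ.rhoJet a * φ.rhoProd u := by
  have hau : a ∉ u := fun h' => lt_irrefl _ (h a h')
  rw [rhoProd, Finset.sort_insert _ (fun b hb => (h b hb).le) hau, List.map_cons, List.prod_cons]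
  rfl

theorem sgn_singleton_of_lt {a : Jet N} {u : Finset (Jet N)} (h : ∀ b ∈ u, a < b) :
    sgn {a} u = 1 := by
  rw [sgn, Finset.prod_singleton]
  exact Finset.prod_eq_one fun b hb => if_neg (h b hb).not_gt

/-- The values of the odd symbols obey the sign rule by which formal generators multiply monomials.
This makes evaluation compatible with `mulGen`. -/
theorem rhoJet_mul_rhoProd (v : Jet N) (u : Finset (Jet N)) : φ.rhoJet v * φ.rhoProd u =
    if v ∈ u then 0 else (sgn {v} u : ℂ) • φ.rhoProd (insert v u) := by
  induction u using Finset.induction_on_min with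
  | empty =>
    have h : ∀ b ∈ (∅ : Finset (Jet N)), v < b := by simp
    rw [if_neg (Finset.notMem_empty v), φ.rhoProd_insert_of_lt h, sgn_singleton_of_lt h,
      Int.cast_one, one_smul]
  | insert a u ha ih =>
    have hau : a ∉ u := fun h => lt_irrefl _ (ha a h)
    rcases lt_trichotomy v a with h | h | h
    · have h' : ∀ b ∈ insert a u, v < b := fun b hb => by
        rcases Finset.mem_insert.1 hb with e | e
        · exact e ▸ h
        · exact h.trans (ha b e)
      rw [if_neg fun h'' => lt_irrefl _ (h' v h''), φ.rhoProd_insert_of_lt h',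
        sgn_singleton_of_lt h', Int.cast_one, one_smul]
    · rw [h, if_pos (Finset.mem_insert_self a u), φ.rhoProd_insert_of_lt ha, ← Grass.mul_assoc,
        rhoJet_mul_self, Grass.zero_mul]
    -- Here the smallest symbol `a` precedes `v`: `v` is moved past it at the cost of one sign and
    -- the induction hypothesis applies to the rest.
    · have hmem : v ∈ insert a u ↔ v ∈ u := by simp [h.ne']
      have ha' : ∀ b ∈ insert v u, a < b := fun b hb => by
        rcases Finset.mem_insert.1 hb with e | e
        · exact e ▸ h
        · exact ha b e
      have hs : sgn {v} (insert a u) = -sgn {v} u := by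
        rw [sgn_insert_right hau]
        simp [sgn, h]
      rw [φ.rhoProd_insert_of_lt ha, ← Grass.mul_assoc, rhoJet_mul_rhoJet, Grass.neg_mul,
        Grass.mul_assoc, ih, Finset.insert_comm, φ.rhoProd_insert_of_lt ha', hs]
      simp only [hmem]
      split_ifs
      · rw [Grass.mul_zero, neg_zero]
      · rw [Grass.mul_smul', Int.cast_neg, neg_smul]

theorem rhoJet_mul_monomial (v : Jet N) (u : Finset (Jet N)) (n : Jet N →₀ ℕ) :
    φ.rhoJet v * φ.monomial u n =
      if v ∈ u then 0 else (sgn {v} u : ℂ) • φ.monomial (insert v u) n := by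
  rw [monomial_eq, ← Grass.mul_assoc, ← lamProd_mul_comm, Grass.mul_assoc, rhoJet_mul_rhoProd]
  split_ifs
  · exact Grass.mul_zero _
  · rw [Grass.mul_smul', monomial_eq]

theorem lamJet_mul_monomial (v : Jet N) (u : Finset (Jet N)) (n : Jet N →₀ ℕ) :
    φ.lamJet v * φ.monomial u n = φ.monomial u (n + Finsupp.single v 1) := by
  rw [monomial_eq, ← Grass.mul_assoc, lamJet_mul_lamProd, monomial_eq]

/-- An irrelevant monomial contains a symbol of level at least `K`, whose value is zero, or too many
nilpotent factors. -/
theorem monomial_eq_zero {K : ℕ} (hK : ∀ α, ∀ k ≥ K, φ.lam α k = 0 ∧ φ.rho α k = 0)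
    {p : Finset (Jet N) × (Jet N →₀ ℕ)} (hp : p ∉ relevant N K (q + 1)) :
    φ.monomial p.1 p.2 = 0 := by
  rw [monomial_eq]
  by_cases h1 : ∀ v ∈ p.1, v.lvl < K
  · by_cases h2 : ∀ v ∈ p.2.support, v.lvl < K
    · have h3 : ¬ p.2.degree ≤ q + 1 := fun h => hp ⟨h1, h2, h⟩
      -- The Grassmann algebra has `q + 1` generators, counting `dz̄`, and each even factor has no
      -- component in degree `∅`.
      have : φ.lamProd p.2 = 0 := Grass.ext fun s => by
        refine prod_map_apply_eq_zero φ.lamJet_empty _ ?_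
        rw [Multiset.length_sort, Finsupp.card_toMultiset]
        have := Finset.card_le_univ s
        rw [Fintype.card_fin] at this
        have h4 : p.2.degree = p.2.sum fun _ => id := rfl
        rw [← h4]
        omega
      rw [this, Grass.zero_mul]
    · push Not at h2
      obtain ⟨v, hv, hvK⟩ := h2
      have : φ.lamProd p.2 = 0 :=
        prod_map_eq_zero (i := v) (by simpa using hv) (φ.lamJet_eq_zero (hK _ _ hvK).1)
      rw [this, Grass.zero_mul]
  · push Not at h1
    obtain ⟨v, hv, hvK⟩ := h1
    have : φ.rhoProd p.1 = 0 :=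
      prod_map_eq_zero (i := v) (by simpa using hv) (φ.rhoJet_eq_zero (hK _ _ hvK).2)
    rw [this, Grass.mul_zero]

theorem eval_apply (L : Density N) (s : Finset (Fin (q + 1))) (z : ℂ) : φ.eval L s z =
    ∑ᶠ p : Finset (Jet N) × (Jet N →₀ ℕ),
      MvPowerSeries.coeff p.2 (L p.1) * φ.monomial p.1 p.2 s z := rfl

theorem eval_congr {K : ℕ} (hK : ∀ α, ∀ k ≥ K, φ.lam α k = 0 ∧ φ.rho α k = 0) {f g : Density N}
    (h : ∀ p ∈ relevant N K (q + 1), MvPowerSeries.coeff p.2 (f p.1) =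
      MvPowerSeries.coeff p.2 (g p.1)) : φ.eval f = φ.eval g := by
  ext1 s
  funext z
  refine finsum_congr fun p => ?_
  by_cases hp : p ∈ relevant N K (q + 1)
  · rw [h p hp]
  · rw [φ.monomial_eq_zero hK hp, Grass.zero_apply, Pi.zero_apply, mul_zero, mul_zero]

theorem finite_support_eval {f : Density N} (hf : f ∈ poly N) (s : Finset (Fin (q + 1))) (z : ℂ) :
    (Function.support fun p : Finset (Jet N) × (Jet N →₀ ℕ) =>
      MvPowerSeries.coeff p.2 (f p.1) * φ.monomial p.1 p.2 s z).Finite :=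
  (finite_monomials hf).subset fun _ hp => left_ne_zero_of_mul hp

/-- A `finsum` with infinite support is `0` by convention, so additivity requires finitely many
monomials. Scaling by a constant requires nothing. -/
theorem eval_add {f g : Density N} (hf : f ∈ poly N) (hg : g ∈ poly N) :
    φ.eval (f + g) = φ.eval f + φ.eval g := by
  ext1 s
  funext z
  rw [Grass.add_apply, Pi.add_apply, eval_apply, eval_apply, eval_apply,
    ← finsum_add_distrib (φ.finite_support_eval hf s z) (φ.finite_support_eval hg s z)]
  refine finsum_congr fun p => ?_
  rw [Grass.add_apply, map_add, add_mul]

theorem eval_smul (c : ℂ) (f : Density N) : φ.eval (c • f) = c • φ.eval f := by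
  ext1 s
  funext z
  rw [Grass.smul_apply, Pi.smul_apply, eval_apply, eval_apply, smul_eq_mul,
    mul_finsum]
  refine finsum_congr fun p => ?_
  rw [Grass.smul_apply, map_smul, smul_eq_mul, mul_assoc]

theorem eval_zero : φ.eval 0 = 0 := by
  simpa using φ.eval_smul 0 0

theorem eval_mono (u : Finset (Jet N)) (n : Jet N →₀ ℕ) : φ.eval (mono u n) = φ.monomial u n := by
  classical
  ext1 s
  funext z
  rw [eval_apply, finsum_eq_single _ (u, n)]
  · rw [coeff_mono, if_pos rfl, one_mul]
  · intro p hp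
    rw [coeff_mono, if_neg hp, zero_mul]

theorem eval_mulGen (v : Jet N) {f : Density N} (hf : f ∈ poly N) :
    φ.eval (mulGen v f) = φ.rhoJet v * φ.eval f := by
  induction hf using Submodule.span_induction with
  | mem x h =>
    obtain ⟨p, rfl⟩ := h
    simp only [eval_mono, rhoJet_mul_monomial]
    split_ifs with h
    · rw [mulGen_mono_of_mem h, eval_zero]
    · rw [mulGen_mono h, eval_smul, eval_mono]
  | zero => rw [mulGen_zero, eval_zero, Grass.mul_zero]
  | add x y hx hy hx' hy' =>
    rw [mulGen_add, eval_add _ (mulGen_mem_poly v hx) (mulGen_mem_poly v hy), hx', hy',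
      eval_add _ hx hy, Grass.mul_add]
  | smul c x hx hx' =>
    rw [mulGen_smul, eval_smul, hx', eval_smul, Grass.mul_smul']

theorem eval_const_X_mul (v : Jet N) {f : Density N} (hf : f ∈ poly N) :
    φ.eval (const (MvPowerSeries.X v) * f) = φ.lamJet v * φ.eval f := by
  induction hf using Submodule.span_induction with
  | mem x h =>
    obtain ⟨p, rfl⟩ := h
    simp only [eval_mono, lamJet_mul_monomial, const_X_mul_mono]
  | zero => rw [Grass.mul_zero, eval_zero, Grass.mul_zero]
  | add x y hx hy hx' hy' =>
    rw [Grass.mul_add, eval_add _ (const_X_mul_mem_poly v hx) (const_X_mul_mem_poly v hy), hx',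
      hy', eval_add _ hx hy, Grass.mul_add]
  | smul c x hx hx' =>
    rw [Grass.mul_smul', eval_smul, hx', eval_smul,
      Grass.mul_smul']

/-- Evaluation intertwines the total derivative with `∂_z`. -/
structure Compatible (f : Density N) : Prop where
  mem : f ∈ poly N
  smooth : (φ.eval f).Smooth
  eval_totalDeriv : φ.eval (totalDeriv f) = (φ.eval f).dz
  holomorphic : φ.DbarClosed → (φ.eval f).Holomorphic

theorem compatible_one : φ.Compatible (mono ∅ 0) := by
  have h1 : φ.eval (mono ∅ 0) = 1 := by
    rw [eval_mono, monomial_eq, lamProd, rhoProd]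
    simp only [map_zero, Multiset.sort_zero, Finset.sort_empty, List.map_nil, List.prod_nil]
    exact Grass.one_mul 1
  have h2 : totalDeriv (mono ∅ 0 : Density N) = 0 := totalDeriv_one
  refine ⟨mono_mem_poly _ _, ?_, ?_, fun _ => ?_⟩
  · rw [h1]; exact Smooth.one
  · rw [h1, h2, eval_zero, dz_one]
  · rw [h1]; exact Holomorphic.one

variable {φ}

/-- Both derivatives satisfy the Leibniz rule, and the value of a raised symbol is `∂_z` of the
value of the symbol. -/
theorem Compatible.mulGen {f : Density N} (h : φ.Compatible f) (v : Jet N) :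
    φ.Compatible (Grass.mulGen v f) where
  mem := mulGen_mem_poly v h.mem
  smooth := by
    rw [φ.eval_mulGen v h.mem]
    exact (φ.smooth_rhoJet v).mul h.smooth
  eval_totalDeriv := by
    rw [totalDeriv_mulGen, φ.eval_add (mulGen_mem_poly _ h.mem)
      (mulGen_mem_poly _ (totalDeriv_mem_poly h.mem)), φ.eval_mulGen _ h.mem, φ.eval_mulGen _ h.mem,
      φ.eval_mulGen _ (totalDeriv_mem_poly h.mem), h.eval_totalDeriv,
      dz_mul (φ.smooth_rhoJet v) h.smooth, rhoJet_raise]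
  holomorphic hφ := by
    rw [φ.eval_mulGen v h.mem]
    exact (hφ.holomorphic_rhoJet v).mul (h.holomorphic hφ)

theorem Compatible.const_X_mul {f : Density N} (h : φ.Compatible f) (v : Jet N) :
    φ.Compatible (const (MvPowerSeries.X v) * f) where
  mem := const_X_mul_mem_poly v h.mem
  smooth := by
    rw [φ.eval_const_X_mul v h.mem]
    exact (φ.smooth_lamJet v).mul h.smooth
  eval_totalDeriv := by
    rw [totalDeriv_const_X_mul, φ.eval_add (const_X_mul_mem_poly _ h.mem)
      (const_X_mul_mem_poly _ (totalDeriv_mem_poly h.mem)), φ.eval_const_X_mul _ h.mem,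
      φ.eval_const_X_mul _ h.mem, φ.eval_const_X_mul _ (totalDeriv_mem_poly h.mem), h.eval_totalDeriv,
      dz_mul (φ.smooth_lamJet v) h.smooth, lamJet_raise]
  holomorphic hφ := by
    rw [φ.eval_const_X_mul v h.mem]
    exact (hφ.holomorphic_lamJet v).mul (h.holomorphic hφ)

-- Monomials are built from `1` by multiplication with generators, which preserves compatibility;
-- linear combinations follow.
variable (φ) in
theorem compatible_of_mem_poly {f : Density N} (hf : f ∈ poly N) : φ.Compatible f := by
  induction hf using Submodule.span_induction with
  | mem x h =>
    obtain ⟨p, rfl⟩ := h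
    exact mono_induction φ.compatible_one (fun v f h => h.const_X_mul v)
      (fun v f h => h.mulGen v) p.1 p.2
  | zero =>
    refine ⟨Submodule.zero_mem _, ?_, ?_, fun _ => ?_⟩
    · rw [eval_zero]; exact Smooth.zero
    · rw [map_zero, eval_zero, dz_zero]
    · rw [eval_zero]; exact Holomorphic.zero
  | add x y _ _ hx hy =>
    have he := φ.eval_add hx.mem hy.mem
    refine ⟨Submodule.add_mem _ hx.mem hy.mem, ?_, ?_, fun hφ => ?_⟩
    · rw [he]; exact hx.smooth.add hy.smooth
    · rw [map_add, φ.eval_add (totalDeriv_mem_poly hx.mem) (totalDeriv_mem_poly hy.mem), he,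
        dz_add hx.smooth hy.smooth, hx.eval_totalDeriv, hy.eval_totalDeriv]
    · rw [he]; exact (hx.holomorphic hφ).add (hy.holomorphic hφ)
  | smul c x _ hx =>
    have he := φ.eval_smul c x
    refine ⟨Submodule.smul_mem _ c hx.mem, ?_, ?_, fun hφ => ?_⟩
    · rw [he]; exact hx.smooth.smul c
    · rw [map_smul, φ.eval_smul, he, dz_smul hx.smooth, hx.eval_totalDeriv]
    · rw [he]; exact (hx.holomorphic hφ).smul c

/-! ### Contour integrals -/

variable (φ)

theorem contour_apply (L : Density N) (s : Finset (Fin q)) : φ.contour L s =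
    ∫ x in (0 : ℝ)..1, φ.eval L (s.map (Fin.succEmb q)) (x : ℂ) := rfl

theorem eval_truncate {K : ℕ} (hK : ∀ α, ∀ k ≥ K, φ.lam α k = 0 ∧ φ.rho α k = 0)
    (f : Density N) : φ.eval f = φ.eval (truncate K (q + 1) f) :=
  φ.eval_congr hK fun _ hp => (coeff_truncate_of_mem f hp).symm

/-- At the given field a tame density has the same value as its truncation, which is polynomial:
there evaluation is additive and its components are smooth, hence integrable. -/
theorem contour_add {K : ℕ} (hK : ∀ α, ∀ k ≥ K, φ.lam α k = 0 ∧ φ.rho α k = 0)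
    {f g : Density N} (hf : Tame K (q + 1) f) (hg : Tame K (q + 1) g) :
    φ.contour (f + g) = φ.contour f + φ.contour g := by
  ext1 s
  have hf' := hf.truncate_mem_poly
  have hg' := hg.truncate_mem_poly
  have hcont : ∀ h ∈ poly N, IntervalIntegrable
      (fun x : ℝ => φ.eval h (s.map (Fin.succEmb q)) (x : ℂ)) MeasureTheory.volume 0 1 :=
    fun h hh => (((φ.compatible_of_mem_poly hh).smooth _).continuous.comp
      Complex.continuous_ofReal).intervalIntegrable _ _
  have he : φ.eval (f + g) = φ.eval f + φ.eval g := by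
    rw [φ.eval_truncate hK f, φ.eval_truncate hK g, ← φ.eval_add hf' hg']
    refine φ.eval_congr hK fun p hp => ?_
    rw [Grass.add_apply, Grass.add_apply, map_add, map_add, coeff_truncate_of_mem f hp,
      coeff_truncate_of_mem g hp]
  rw [Grass.add_apply, contour_apply, contour_apply, contour_apply, he, φ.eval_truncate hK f,
    φ.eval_truncate hK g, ← intervalIntegral.integral_add (hcont _ hf') (hcont _ hg')]
  rfl

theorem contour_smul (c : ℂ) (f : Density N) : φ.contour (c • f) = c • φ.contour f := by
  ext1 s
  rw [Grass.smul_apply, contour_apply, contour_apply, eval_smul,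
    ← intervalIntegral.integral_smul]
  rfl

variable {φ} in
/-- The contour integral of a total derivative vanishes on `∂̄`-closed fields. -/
theorem DbarClosed.contour_totalDeriv (hφ : φ.DbarClosed) {K : ℕ}
    (hK : ∀ α, ∀ k ≥ K, φ.lam α k = 0 ∧ φ.rho α k = 0) {f : Density N}
    (hf : Tame K (q + 1) f) : φ.contour (totalDeriv f) = 0 := by
  ext1 s
  have hc := φ.compatible_of_mem_poly hf.truncate_mem_poly
  have he : φ.eval (totalDeriv f) = (φ.eval (truncate K (q + 1) f)).dz := by
    rw [← hc.eval_totalDeriv]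
    exact φ.eval_congr hK (coeff_totalDeriv_truncate f)
  -- The index set is a shifted one and so avoids `0`, the generator `dz̄`; this component is
  -- therefore holomorphic and periodic.
  set F : ℂ → ℂ := φ.eval (truncate K (q + 1) f) (s.map (Fin.succEmb q)) with hF
  obtain ⟨hd, hper⟩ : Differentiable ℂ F ∧ ∀ z, F (z + 1) = F z :=
    hc.holomorphic hφ _ (by simp)
  rw [contour_apply, he, Grass.zero_apply]
  change ∫ x in (0 : ℝ)..1, wirtinger F x = 0
  -- The integral becomes `F 1 - F 0`, which is zero by periodicity.
  rw [wirtinger_eq_deriv hd, intervalIntegral.integral_eq_sub_of_hasDerivAt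
    (f := fun x : ℝ => F x) (fun x _ => (hd x).hasDerivAt.comp_ofReal)
    ((hd.deriv.continuous.comp Complex.continuous_ofReal).intervalIntegrable _ _)]
  have := hper 0
  rw [zero_add] at this
  simp [this]

end BCOVField

/-! ### Bounds on the number of derivatives, and the theorem. -/

theorem Correlators.weightLE_density {N : ℕ} {H : Type*} [AddCommGroup H] [Module ℂ H]
    (T : Correlators N H) : Density.WeightLE 0 T.density :=
  Density.weightLE_oddSum fun _ => Density.weightLE_const_rename_base _

theorem Correlators.weightLE_primitive {N : ℕ} {H : Type*} [AddCommGroup H] [Module ℂ H]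
    (T : Correlators N H) : Density.WeightLE 0 T.primitive :=
  (Density.weightLE_oddSum fun _ => Density.weightLE_oddSum fun _ =>
    Density.weightLE_const_rename_base _).smul _

theorem mainTheorem5 {N : ℕ} {H : Type*} [AddCommGroup H] [Module ℂ H] (T : GenusZeroTFT N H) :
    (currentDelta (current T.density) + (1 / 2 : ℂ) •
        currentBracket T.metric⁻¹ (current T.density) (current T.density) = 0) ∧
    (∀ (q : ℕ) (φ : BCOVField N q), φ.DbarClosed →
      φ.contour (Density.delta T.density) + (1 / 2 : ℂ) •
        φ.contour (Density.hamDeriv T.metric⁻¹ T.density T.density) = 0) := by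
  have key := T.delta_add_half_hamDeriv
  refine ⟨?_, fun q φ hφ => ?_⟩
  · have h : current (Density.delta T.density) + (1 / 2 : ℂ) •
        current (Density.hamDeriv T.metric⁻¹ T.density T.density) = 0 := by
      rw [← map_smul, ← map_add, key]
      exact (Submodule.Quotient.mk_eq_zero _).2 ⟨_, rfl⟩
    -- The differential and the bracket on classes are computed on representatives by definition of
    -- the quotient maps.
    exact h
  · obtain ⟨K, hK⟩ := φ.finite
    have h1 : Density.Tame K (q + 1) (Density.delta T.density) :=
      (Density.weightLE_delta T.weightLE_density).tame _ _
    have h2 : Density.Tame K (q + 1) T.primitive := T.weightLE_primitive.tame _ _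
    have h3 : Density.Tame K (q + 1)
        (Density.hamDeriv T.metric⁻¹ T.density T.density) := by
      -- Solving the identity for the bracket term gives its tameness from that of the other two
      -- terms, without a separate weight estimate for `hamDeriv`.
      have e : Density.hamDeriv T.metric⁻¹ T.density T.density =
          (2 : ℂ) • Density.totalDeriv T.primitive + (-2 : ℂ) • Density.delta T.density := by
        rw [← key]
        module
      rw [e]
      exact (h2.totalDeriv.smul _).add (h1.smul _)
    rw [← φ.contour_smul, ← φ.contour_add hK h1 (h3.smul _), key,
      hφ.contour_totalDeriv hK h2]
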